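/- Let $p\ge 3$ be a prime, and fix a unit $\rho\in\mathbb{Z}_p^*$ that is not a square modulo $p$. A $3$-dimensional $\mathbb{Z}_p$-Lie lattice is a Lie algebra over $\mathbb{Z}_p$ whose underlying module is free of rank $3$; it is unsolvable if it is not solvable as a Lie algebra. For $a_0,a_1,a_2\in\mathbb{Z}_p$, let $L(a_0,a_1,a_2)$ denote the Lie lattice with basis $x_0,x_1,x_2$ presented by $$\langle\, x_0,x_1,x_2 \mid [x_1,x_2]=a_0x_0,\ [x_2,x_0]=a_1x_1,\ [x_0,x_1]=a_2x_2\,\rangle .$$ Then every $3$-dimensional unsolvable $\mathbb{Z}_p$-Lie lattice is isomorphic to exactly one of the following Lie lattices (one family and one choice of its parameters): 1. $L_1(s_0,s_1,s_2,\varepsilon_1,\varepsilon_2)=L(p^{s_0},\ \rho^{\varepsilon_1}p^{s_1},\ \rho^{\varepsilon_2}p^{s_2})$ with integers $0\le s_0<s_1<s_2$ and $\varepsilon_1,\varepsilon_2\in\{0,1\}$; 2. $L_2(s_0,s_2,\varepsilon_1)=L(p^{s_0},\ -\rho^{\varepsilon_1}p^{s_0},\ p^{s_2})$ with integers $0\le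 s_0<s_2$ and $\varepsilon_1\in\{0,1\}$; 3. $L_3(s_0,s_1,\varepsilon_2)=L(p^{s_0},\ p^{s_1},\ -\rho^{\varepsilon_2}p^{s_1})$ with integers $0\le s_0<s_1$ and $\varepsilon_2\in\{0,1\}$; 4. $L_4(s_0)=L(p^{s_0},\ p^{s_0},\ p^{s_0})$ with an integer $s_0\ge 0$. A virtual endomorphism of index $d$ of a Lie lattice $L$ is a Lie algebra morphism $\varphi:M\to L$, where $M\subseteq L$ is a subalgebra of the same dimension as $L$ and of index $d$ in $L$. It is simple if no non-zero ideal $I$ of $L$ satisfies both $I\subseteq M$ and $\varphi(I)\subseteq I$. The lattice $L$ is self-similar of index $d$ if it admits a simple virtual endomorphism of index $d$. Moreover, for all values of the parameters as above: 1. $L_1(s_0,s_1,s_2,\varepsilon_1,\varepsilon_2)$ is not self-similar of index $p$; 2. $L_2(s_0,s_2,\varepsilon_1)$ is self-similar of index $p$ if and only if $\varepsilon_1=0$; 3. $L_3(s_0,s_1,\varepsilon_2)$ is self-similar of index $p$ if and only if $\varepsilon_2=0$; 4. $L_4(s_0)$ is self-similar of index $p$. -/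

import Mathlib

/-- A virtual endomorphism of a `ℤ_[p]`-Lie lattice `L`: a morphism of Lie algebras `φ : M → L`,
where `M` is a subalgebra of `L` of the same dimension as `L`. -/
structure VirtualEndomorphism (p : ℕ) [Fact p.Prime] (L : Type*) [LieRing L]
    [LieAlgebra ℤ_[p] L] where
  /-- The domain `M`. -/
  domain : LieSubalgebra ℤ_[p] L
  /-- The dimension of `M` is that of `L`. -/
  finrank_domain : Module.finrank ℤ_[p] domain = Module.finrank ℤ_[p] L
  /-- The morphism `φ : M → L`. -/
  hom : domain →ₗ⁅ℤ_[p]⁆ L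

namespace VirtualEndomorphism

variable {p : ℕ} [Fact p.Prime] {L : Type*} [LieRing L] [LieAlgebra ℤ_[p] L]

/-- The index of `φ : M → L` is the index of the additive group of `M` in that of `L`. -/
noncomputable def index (φ : VirtualEndomorphism p L) : ℕ :=
  φ.domain.toSubmodule.toAddSubgroup.index

/-- An ideal `I` of `L` is `φ`-invariant if `I ⊆ M` and `φ(I) ⊆ I`. -/
def IsInvariant (φ : VirtualEndomorphism p L) (I : LieIdeal ℤ_[p] L) : Prop :=
  (∀ x ∈ I, x ∈ φ.domain) ∧ ∀ x : φ.domain, (x : L) ∈ I → φ.hom x ∈ I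

/-- `φ` is simple if the only `φ`-invariant ideal of `L` is zero. -/
def IsSimple (φ : VirtualEndomorphism p L) : Prop :=
  ∀ I : LieIdeal ℤ_[p] L, φ.IsInvariant I → I = ⊥

end VirtualEndomorphism

/-- `L` is self-similar of index `d` if it admits a simple virtual endomorphism of index `d`. -/
def IsSelfSimilarOfIndex (p : ℕ) [Fact p.Prime] (L : Type*) [LieRing L] [LieAlgebra ℤ_[p] L]
    (d : ℕ) : Prop :=
  1 ≤ d ∧ ∃ φ : VirtualEndomorphism p L, φ.IsSimple ∧ φ.index = d

/-- The Lie lattice over `R` presented by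
`⟨x₀, x₁, x₂ ∣ [x₁, x₂] = a₀ x₀, [x₂, x₀] = a₁ x₁, [x₀, x₁] = a₂ x₂⟩`,
realized on the free module `R³` with standard basis `x₀, x₁, x₂`. -/
def DiagLieLattice {R : Type*} (_a : Fin 3 → R) : Type _ := Fin 3 → R

namespace DiagLieLattice

variable {R : Type*} [CommRing R] (a : Fin 3 → R)

instance : AddCommGroup (DiagLieLattice a) := inferInstanceAs (AddCommGroup (Fin 3 → R))

instance : Module R (DiagLieLattice a) := inferInstanceAs (Module R (Fin 3 → R))

instance : Bracket (DiagLieLattice a) (DiagLieLattice a) where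
  bracket v w :=
    (![a 0 * (v 1 * w 2 - v 2 * w 1), a 1 * (v 2 * w 0 - v 0 * w 2),
      a 2 * (v 0 * w 1 - v 1 * w 0)] : Fin 3 → R)

variable {a} in
theorem lie_apply_zero (v w : DiagLieLattice a) :
    ⁅v, w⁆ 0 = a 0 * (v 1 * w 2 - v 2 * w 1) := rfl

variable {a} in
theorem lie_apply_one (v w : DiagLieLattice a) :
    ⁅v, w⁆ 1 = a 1 * (v 2 * w 0 - v 0 * w 2) := rfl

variable {a} in
theorem lie_apply_two (v w : DiagLieLattice a) :
    ⁅v, w⁆ 2 = a 2 * (v 0 * w 1 - v 1 * w 0) := rfl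

variable {a} in
theorem add_apply (v w : DiagLieLattice a) (i : Fin 3) : (v + w) i = v i + w i := rfl

variable {a} in
theorem zero_apply (i : Fin 3) : (0 : DiagLieLattice a) i = 0 := rfl

variable {a} in
theorem smul_apply (r : R) (v : DiagLieLattice a) (i : Fin 3) : (r • v) i = r * v i := rfl

instance : LieRing (DiagLieLattice a) where
  add_lie x y z := by
    funext i; fin_cases i <;> simp [lie_apply_zero, lie_apply_one, lie_apply_two, add_apply] <;> ring
  lie_add x y z := by
    funext i; fin_cases i <;> simp [lie_apply_zero, lie_apply_one, lie_apply_two, add_apply] <;> ring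
  lie_self x := by
    funext i; fin_cases i <;> simp [lie_apply_zero, lie_apply_one, lie_apply_two, zero_apply] <;> ring
  leibniz_lie x y z := by
    funext i; fin_cases i <;> simp [lie_apply_zero, lie_apply_one, lie_apply_two, add_apply] <;> ring

instance : LieAlgebra R (DiagLieLattice a) where
  lie_smul r x y := by
    funext i; fin_cases i <;> simp [lie_apply_zero, lie_apply_one, lie_apply_two, smul_apply] <;> ring

/-- The standard basis `x₀, x₁, x₂`. -/
noncomputable def stdBasis : Module.Basis (Fin 3) R (DiagLieLattice a) := Pi.basisFun R (Fin 3)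

/-- The defining relations hold for the standard basis. -/
theorem stdBasis_relations :
    ⁅stdBasis a 1, stdBasis a 2⁆ = a 0 • stdBasis a 0 ∧
    ⁅stdBasis a 2, stdBasis a 0⁆ = a 1 • stdBasis a 1 ∧
    ⁅stdBasis a 0, stdBasis a 1⁆ = a 2 • stdBasis a 2 := by
  have h : ∀ i j, (stdBasis a i) j = if j = i then 1 else 0 := by
    intro i j
    change (Pi.basisFun R (Fin 3) i) j = _
    simp [Pi.single_apply]
  refine ⟨?_, ?_, ?_⟩ <;> funext i <;> fin_cases i <;> simp [lie_apply_zero, lie_apply_one, lie_apply_two, smul_apply, h]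

/-- The universal property of the presentation. -/
theorem existsUnique_lift {L : Type*} [LieRing L] [LieAlgebra R L] (y : Fin 3 → L)
    (h0 : ⁅y 1, y 2⁆ = a 0 • y 0) (h1 : ⁅y 2, y 0⁆ = a 1 • y 1) (h2 : ⁅y 0, y 1⁆ = a 2 • y 2) :
    ∃! f : DiagLieLattice a →ₗ⁅R⁆ L, ∀ i, f (stdBasis a i) = y i := by
  have hf : ∀ v : DiagLieLattice a,
      (stdBasis a).constr R y v = v 0 • y 0 + v 1 • y 1 + v 2 • y 2 := by
    intro v
    rw [Module.Basis.constr_apply_fintype, Fin.sum_univ_three]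
    rfl
  refine ⟨{ (stdBasis a).constr R y with map_lie' := ?_ }, ?_, ?_⟩
  · intro v w
    change (stdBasis a).constr R y ⁅v, w⁆ =
      ⁅(stdBasis a).constr R y v, (stdBasis a).constr R y w⁆
    have h0' : ⁅y 2, y 1⁆ = -(a 0 • y 0) := by rw [← h0, lie_skew]
    have h1' : ⁅y 0, y 2⁆ = -(a 1 • y 1) := by rw [← h1, lie_skew]
    have h2' : ⁅y 1, y 0⁆ = -(a 2 • y 2) := by rw [← h2, lie_skew]
    simp only [hf, lie_add, add_lie, lie_smul, smul_lie, lie_self, h0, h1, h2, h0', h1', h2',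
      lie_apply_zero, lie_apply_one, lie_apply_two]
    module
  · intro i
    exact (stdBasis a).constr_basis R y i
  · intro g hg
    ext v
    have : (g : DiagLieLattice a →ₗ[R] L) = (stdBasis a).constr R y :=
      (stdBasis a).ext fun i => by
        rw [(stdBasis a).constr_basis]; exact hg i
    exact LinearMap.congr_fun this v

end DiagLieLattice

/-- The parameters of the four families `L₁(s₀, s₁, s₂, ε₁, ε₂)`, `L₂(s₀, s₂, ε₁)`,
`L₃(s₀, s₁, ε₂)`, `L₄(s₀)`. -/
inductive CanonicalParam : Type
  | L₁ (s₀ s₁ s₂ : ℕ) (h₀₁ : s₀ < s₁) (h₁₂ : s₁ < s₂) (ε₁ ε₂ : Fin 2) : CanonicalParam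
  | L₂ (s₀ s₂ : ℕ) (h₀₂ : s₀ < s₂) (ε₁ : Fin 2) : CanonicalParam
  | L₃ (s₀ s₁ : ℕ) (h₀₁ : s₀ < s₁) (ε₂ : Fin 2) : CanonicalParam
  | L₄ (s₀ : ℕ) : CanonicalParam

/-- The coefficients `a₀, a₁, a₂` in the presentations of the four families. -/
noncomputable def CanonicalParam.coeff {p : ℕ} [Fact p.Prime] (ρ : ℤ_[p]ˣ) : CanonicalParam → Fin 3 → ℤ_[p]
  | L₁ s₀ s₁ s₂ _ _ ε₁ ε₂ =>
    ![(p : ℤ_[p]) ^ s₀, (ρ : ℤ_[p]) ^ (ε₁ : ℕ) * (p : ℤ_[p]) ^ s₁,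
      (ρ : ℤ_[p]) ^ (ε₂ : ℕ) * (p : ℤ_[p]) ^ s₂]
  | L₂ s₀ s₂ _ ε₁ =>
    ![(p : ℤ_[p]) ^ s₀, -((ρ : ℤ_[p]) ^ (ε₁ : ℕ) * (p : ℤ_[p]) ^ s₀), (p : ℤ_[p]) ^ s₂]
  | L₃ s₀ s₁ _ ε₂ =>
    ![(p : ℤ_[p]) ^ s₀, (p : ℤ_[p]) ^ s₁, -((ρ : ℤ_[p]) ^ (ε₂ : ℕ) * (p : ℤ_[p]) ^ s₁)]
  | L₄ s₀ => ![(p : ℤ_[p]) ^ s₀, (p : ℤ_[p]) ^ s₀, (p : ℤ_[p]) ^ s₀]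

/-- The Lie lattice with given parameters. -/
abbrev CanonicalParam.lattice {p : ℕ} [Fact p.Prime] (ρ : ℤ_[p]ˣ) (c : CanonicalParam) :
    Type :=
  DiagLieLattice (c.coeff ρ)

/-! Classification. On a basis `y` of a lattice of rank 3, the three brackets of cyclically ordered
pairs are combinations of the basis, with a coefficient matrix `A`. Replacing the basis by `u` times
the cofactor matrix of `Q` turns `A` into `u • (Q * A * Qᵀ)`. If `det A = 0`, the lattice is
solvable (`HasBrackets.isSolvable`); otherwise the Jacobi identity forces `A` to be symmetric
(`HasBrackets.isSymm`). So the problem becomes that of ternary quadratic forms up to congruence and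
a unit factor. As 2 is a unit, such a form can be diagonalized. Units modulo squares are represented
by 1 and `ρ`, and a binary form with unit coefficients represents 1; this brings the diagonal into
one of the four families. For uniqueness, the matrix of an isomorphism satisfies quadratic
identities that determine the valuations of the coefficients and then, modulo `p`, the exponents of
`ρ`.

Obstruction. If `φ : M → L` has index `p`, then `pL ⊆ M`, and `g x = φ (p x)` is linear on `L` with
`[g x, g y] = p g [x, y]`. Since `g = pφ` on `M`, its matrix `G` has rank at most 1 modulo `p`.
Hence the `2 × 2` minors are divisible by `p`, which bounds the valuations of the entries below
(`dvd_mul_entry`). Moreover `det G` is 0 or `p ^ 3`, so `g` multiplies the invariant form by 0 or `p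
^ 2` (`sq_mul_formCoeff_dvd`). For three distinct valuations, or when the two coefficients of equal
valuation give a form anisotropic modulo `p`, these constraints make some ideal spanned by the `p ^
(1 + n i) • x i` invariant under `φ`.

Construction. In the remaining cases there is a basis resembling a standard basis of `sl₂`. Dividing
one root vector by `p` and multiplying the opposite one by `p` respects the brackets; an invariant
ideal has zero coordinate along the first root vector, and bracketing then shows that it is zero. -/

namespace PadicInt

/-! ### Squares and binary quadratic forms over the `p`-adic integers. -/

variable {p : ℕ} [Fact p.Prime]

theorem toZMod_eq_zero_iff_dvd (x : ℤ_[p]) : toZMod x = 0 ↔ (p : ℤ_[p]) ∣ x := by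
  rw [← RingHom.mem_ker, ker_toZMod, maximalIdeal_eq_span_p, Ideal.mem_span_singleton]

theorem isUnit_iff_not_dvd (x : ℤ_[p]) : IsUnit x ↔ ¬ (p : ℤ_[p]) ∣ x := by
  rw [← toZMod_eq_zero_iff_dvd, ← RingHom.mem_ker, ker_toZMod, IsLocalRing.mem_maximalIdeal,
    mem_nonunits_iff, not_not]

theorem toZMod_surjective : Function.Surjective (toZMod : ℤ_[p] →+* ZMod p) :=
  ZMod.ringHom_surjective _

theorem isUnit_two (hp : 3 ≤ p) : IsUnit (2 : ℤ_[p]) := by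
  rw [isUnit_iff_not_dvd, ← toZMod_eq_zero_iff_dvd, map_ofNat]
  intro h
  have h2 : ((2 : ℕ) : ZMod p) = 0 := by exact_mod_cast h
  rw [ZMod.natCast_eq_zero_iff] at h2
  have := Nat.le_of_dvd (by norm_num) h2
  omega

theorem exists_sq_eq_of_isSquare_toZMod (hp : 3 ≤ p) {x : ℤ_[p]} (hx : IsUnit x)
    (h : IsSquare (toZMod x)) : ∃ y : ℤ_[p]ˣ, (y : ℤ_[p]) ^ 2 = x := by
  obtain ⟨r, hr⟩ := h
  obtain ⟨a, rfl⟩ := toZMod_surjective r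
  have hpx : toZMod x ≠ 0 := by
    rw [Ne, toZMod_eq_zero_iff_dvd]; exact (isUnit_iff_not_dvd x).1 hx
  have ha : IsUnit a := by
    rw [isUnit_iff_not_dvd, ← toZMod_eq_zero_iff_dvd]
    intro h0
    rw [h0] at hr
    exact hpx (by simpa using hr)
  -- The derivative `2 * a` of `X ^ 2 - x` at `a` is a unit, so Hensel's lemma only asks that `a ^ 2
  -- - x` have norm less than 1.
  have h2a : ‖(1 + 1 : ℤ_[p])‖ * ‖a‖ = 1 := by
    rw [one_add_one_eq_two, ← norm_mul]; exact isUnit_iff.1 ((isUnit_two hp).mul ha)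
  have hdvd : (p : ℤ_[p]) ∣ a ^ 2 - x := by
    rw [← toZMod_eq_zero_iff_dvd, map_sub, map_pow, hr]; ring
  have hlt : ‖a ^ 2 - x‖ < 1 := by
    by_contra hn
    exact (isUnit_iff_not_dvd _).1
      (isUnit_iff.2 (le_antisymm (norm_le_one _) (not_lt.1 hn))) hdvd
  obtain ⟨z, hz, -⟩ := hensels_lemma (F := (Polynomial.X ^ 2 - Polynomial.C x : Polynomial ℤ_[p]))
    (a := a) (by simpa [h2a] using hlt)
  have hz' : z ^ 2 = x := by
    simpa [sub_eq_zero] using hz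
  have hzu : IsUnit z := by
    rw [← hz'] at hx
    exact (isUnit_pow_iff two_ne_zero).1 hx
  exact ⟨hzu.unit, hz'⟩

theorem isSquare_mul_of_not_isSquare {a b : ZMod p} (ha : ¬ IsSquare a)
    (hb : ¬ IsSquare b) : IsSquare (a * b) := by
  have h0 : ∀ {c : ZMod p}, ¬ IsSquare c → c ≠ 0 := by
    rintro c hc rfl; exact hc (IsSquare.zero)
  have hodd : ∀ {c : ZMod p}, ¬ IsSquare c → c ^ (p / 2) = -1 := by
    intro c hc
    rcases ZMod.pow_div_two_eq_neg_one_or_one p (h0 hc) with h | h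
    · exact absurd ((ZMod.euler_criterion p (h0 hc)).2 h) hc
    · exact h
  rw [ZMod.euler_criterion p (mul_ne_zero (h0 ha) (h0 hb)), mul_pow, hodd ha, hodd hb]
  norm_num

/-- The squares have index 2 in the unit group. The square is placed next to `u` because it will
serve to rescale a basis vector. -/
theorem exists_eq_pow_mul_sq (hp : 3 ≤ p) (ρ : ℤ_[p]ˣ) (hρ : ¬ IsSquare (toZMod (ρ : ℤ_[p])))
    (u : ℤ_[p]ˣ) :
    ∃ (ε : Fin 2) (c : ℤ_[p]ˣ), (ρ : ℤ_[p]) ^ (ε : ℕ) = (u : ℤ_[p]) * (c : ℤ_[p]) ^ 2 := by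
  by_cases hu : IsSquare (toZMod (u : ℤ_[p]))
  · obtain ⟨y, hy⟩ := exists_sq_eq_of_isSquare_toZMod hp u.isUnit hu
    refine ⟨0, y⁻¹, ?_⟩
    have h1 : (y : ℤ_[p]) * (y⁻¹ : ℤ_[p]ˣ) = 1 := y.mul_inv
    rw [← hy, ← mul_pow, h1]; simp
  · obtain ⟨y, hy⟩ := exists_sq_eq_of_isSquare_toZMod hp (ρ.isUnit.mul u.isUnit) (by
      rw [map_mul]; exact isSquare_mul_of_not_isSquare hρ hu)
    refine ⟨1, u⁻¹ * y, ?_⟩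
    have h1 : (u : ℤ_[p]) * (u⁻¹ : ℤ_[p]ˣ) = 1 := u.mul_inv
    rw [Units.val_mul, mul_pow, hy]
    simp only [Fin.val_one, pow_one]
    linear_combination (-(ρ : ℤ_[p])) * (1 + (u : ℤ_[p]) * (u⁻¹ : ℤ_[p]ˣ)) * h1

/-- Modulo `p` a solution exists over the finite field. The form takes on any lift of it a value
congruent to 1, hence the square of a unit `c`, and dividing the lift by `c` makes the value exactly
1. -/
theorem exists_mul_sq_add_mul_sq_eq_one (hp : 3 ≤ p) {u v : ℤ_[p]} (hu : IsUnit u)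
    (hv : IsUnit v) : ∃ x y : ℤ_[p], u * x ^ 2 + v * y ^ 2 = 1 := by
  have hne : ∀ {w : ℤ_[p]}, IsUnit w → toZMod w ≠ 0 := by
    intro w hw
    rw [Ne, toZMod_eq_zero_iff_dvd]; exact (isUnit_iff_not_dvd w).1 hw
  have hcard : Fintype.card (ZMod p) % 2 = 1 := by
    rw [ZMod.card]
    rcases (Fact.out : p.Prime).eq_two_or_odd with h | h
    · omega
    · exact h
  obtain ⟨a, b, hab⟩ := FiniteField.exists_root_sum_quadratic
    (f := Polynomial.C (toZMod u) * Polynomial.X ^ 2)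
    (g := Polynomial.C (toZMod v) * Polynomial.X ^ 2 + Polynomial.C 0 * Polynomial.X
      + Polynomial.C (-1))
    (Polynomial.degree_C_mul_X_pow 2 (hne hu)) (Polynomial.degree_quadratic (hne hv)) hcard
  obtain ⟨x, rfl⟩ := toZMod_surjective a
  obtain ⟨y, rfl⟩ := toZMod_surjective b
  have h1 : toZMod (u * x ^ 2 + v * y ^ 2) = 1 := by
    simp only [Polynomial.eval_add, Polynomial.eval_mul, Polynomial.eval_C, Polynomial.eval_pow,
      Polynomial.eval_X] at hab
    rw [map_add, map_mul, map_mul, map_pow, map_pow]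
    linear_combination hab
  have hunit : IsUnit (u * x ^ 2 + v * y ^ 2) := by
    rw [isUnit_iff_not_dvd, ← toZMod_eq_zero_iff_dvd, h1]; exact one_ne_zero
  obtain ⟨c, hc⟩ := exists_sq_eq_of_isSquare_toZMod hp hunit (by rw [h1]; exact IsSquare.one)
  refine ⟨x * (c⁻¹ : ℤ_[p]ˣ), y * (c⁻¹ : ℤ_[p]ˣ), ?_⟩
  have h2 : (c : ℤ_[p]) * (c⁻¹ : ℤ_[p]ˣ) = 1 := c.mul_inv
  linear_combination (-((c⁻¹ : ℤ_[p]ˣ) : ℤ_[p]) ^ 2) * hc + (1 + (c : ℤ_[p]) * (c⁻¹ : ℤ_[p]ˣ)) * h2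

/-- The norm form of the quadratic extension defined by a nonsquare is anisotropic modulo `p`. -/
theorem dvd_of_dvd_sq_sub_mul_sq {ρ : ℤ_[p]} (hρ : ¬ IsSquare (toZMod ρ)) {x y : ℤ_[p]}
    (h : (p : ℤ_[p]) ∣ x ^ 2 - ρ * y ^ 2) : (p : ℤ_[p]) ∣ x ∧ (p : ℤ_[p]) ∣ y := by
  simp only [← toZMod_eq_zero_iff_dvd, map_sub, map_mul, map_pow] at h ⊢
  have hy : toZMod y = 0 := by
    by_contra hy
    refine hρ ⟨toZMod x / toZMod y, ?_⟩
    field_simp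
    linear_combination -h
  rw [hy] at h
  exact ⟨by simpa using h, hy⟩

theorem exponent_eq_of_dvd {ρ : ℤ_[p]ˣ} (hρ : ¬ IsSquare (toZMod (ρ : ℤ_[p]))) {ε ε' : Fin 2}
    {x : ℤ_[p]} (h : (p : ℤ_[p]) ∣ (ρ : ℤ_[p]) ^ (ε : ℕ) * x ^ 2 - (ρ : ℤ_[p]) ^ (ε' : ℕ)) :
    ε = ε' := by
  fin_cases ε <;> fin_cases ε' <;> simp at h ⊢
  · refine hρ ⟨toZMod x, ?_⟩
    rw [← toZMod_eq_zero_iff_dvd, map_sub, map_pow] at h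
    linear_combination -h
  · have := (dvd_of_dvd_sq_sub_mul_sq hρ (x := 1) (y := x)
      (by rw [← dvd_neg]; convert h using 1; ring)).1
    exact (isUnit_iff_not_dvd 1).1 isUnit_one this

end PadicInt

/-- The matrix of signed `2 × 2` minors of a `3 × 3` matrix. -/
def Matrix.minorMatrix {R : Type*} [CommRing R] (G : Matrix (Fin 3) (Fin 3) R) :
    Matrix (Fin 3) (Fin 3) R :=
  !![G 1 1 * G 2 2 - G 2 1 * G 1 2, G 1 2 * G 2 0 - G 2 2 * G 1 0, G 1 0 * G 2 1 - G 2 0 * G 1 1;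
     G 2 1 * G 0 2 - G 0 1 * G 2 2, G 2 2 * G 0 0 - G 0 2 * G 2 0, G 2 0 * G 0 1 - G 0 0 * G 2 1;
     G 0 1 * G 1 2 - G 1 1 * G 0 2, G 0 2 * G 1 0 - G 1 2 * G 0 0, G 0 0 * G 1 1 - G 1 0 * G 0 1]

/-! ### Matrix identities for maps that respect brackets up to a scalar. -/

namespace DiagLieLattice

section Matrices

variable {R : Type*} [CommRing R]

/-- `G` is the matrix of a linear map `g` from the lattice of `a` to that of `a'` with
`[g x, g y] = c g [x, y]`. -/
def IsScaledHom (c : R) (a a' : Fin 3 → R) (G : Matrix (Fin 3) (Fin 3) R) : Prop :=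
  ∀ i j, a' i * G.minorMatrix i j = c * a j * G i j

/-- The diagonal entries of the invariant form. -/
def formCoeff (a : Fin 3 → R) : Fin 3 → R := ![a 1 * a 2, a 0 * a 2, a 0 * a 1]

theorem isScaledHom_of_map_lie {c : R} {a a' : Fin 3 → R}
    (g : DiagLieLattice a →ₗ[R] DiagLieLattice a') (hg : ∀ x y, ⁅g x, g y⁆ = c • g ⁅x, y⁆) :
    IsScaledHom c a a' (Matrix.of fun i j => g (stdBasis a j) i) := by
  obtain ⟨h0, h1, h2⟩ := stdBasis_relations a
  have e0 := hg (stdBasis a 1) (stdBasis a 2)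
  have e1 := hg (stdBasis a 2) (stdBasis a 0)
  have e2 := hg (stdBasis a 0) (stdBasis a 1)
  rw [h0, map_smul] at e0
  rw [h1, map_smul] at e1
  rw [h2, map_smul] at e2
  intro i j
  have f0 := congrFun e0 i
  have f1 := congrFun e1 i
  have f2 := congrFun e2 i
  fin_cases j <;> fin_cases i <;>
    simp only [Matrix.minorMatrix, Matrix.of_apply, Fin.zero_eta, Fin.mk_one, Fin.reduceFinMk,
      Matrix.cons_val', Matrix.cons_val_zero, Matrix.cons_val_one, Matrix.cons_val,
      Matrix.cons_val_fin_one, lie_apply_zero, lie_apply_one, lie_apply_two, smul_apply]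
      at f0 f1 f2 ⊢ <;>
    first
      | linear_combination f0
      | linear_combination f1
      | linear_combination f2

namespace IsScaledHom

variable {c : R} {a a' : Fin 3 → R} {G : Matrix (Fin 3) (Fin 3) R}

/-- Laplace expansion along row `i`: these are the diagonal entries of `det G • diag a' = c • G *
diag a * Gᵀ`. -/
theorem mul_det (h : IsScaledHom c a a' G) (i : Fin 3) :
    a' i * G.det = c * (a 0 * G i 0 ^ 2 + a 1 * G i 1 ^ 2 + a 2 * G i 2 ^ 2) := by
  have h0 := h i 0
  have h1 := h i 1
  have h2 := h i 2
  rw [Matrix.det_fin_three]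
  fin_cases i <;> simp [Matrix.minorMatrix] at h0 h1 h2 ⊢ <;>
    first
      | linear_combination G 0 0 * h0 + G 0 1 * h1 + G 0 2 * h2
      | linear_combination G 1 0 * h0 + G 1 1 * h1 + G 1 2 * h2
      | linear_combination G 2 0 * h0 + G 2 1 * h1 + G 2 2 * h2

/-- Laplace expansion along column `j`, each row `i` being weighted by the product of the two
coefficients of `a'` other than `a' i`. -/
theorem mul_form (h : IsScaledHom c a a' G) (j : Fin 3) :
    c * a j * (formCoeff a' 0 * G 0 j ^ 2 + formCoeff a' 1 * G 1 j ^ 2 + formCoeff a' 2 * G 2 j ^ 2)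
      = a' 0 * a' 1 * a' 2 * G.det := by
  have h0 := h 0 j
  have h1 := h 1 j
  have h2 := h 2 j
  rw [Matrix.det_fin_three]
  fin_cases j <;> simp [Matrix.minorMatrix, formCoeff] at h0 h1 h2 ⊢ <;>
    first
      | linear_combination (-a' 1 * a' 2 * G 0 0) * h0 - (a' 0 * a' 2 * G 1 0) * h1
          - (a' 0 * a' 1 * G 2 0) * h2
      | linear_combination (-a' 1 * a' 2 * G 0 1) * h0 - (a' 0 * a' 2 * G 1 1) * h1
          - (a' 0 * a' 1 * G 2 1) * h2
      | linear_combination (-a' 1 * a' 2 * G 0 2) * h0 - (a' 0 * a' 2 * G 1 2) * h1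
          - (a' 0 * a' 1 * G 2 2) * h2

/-- Take determinants of both sides of the defining relation; the cofactor matrix has determinant
`G.det ^ 2`. -/
theorem det_sq (h : IsScaledHom c a a' G) :
    a' 0 * a' 1 * a' 2 * G.det ^ 2 = c ^ 3 * (a 0 * a 1 * a 2) * G.det := by
  have e : (Matrix.of fun i j => a' i * G.minorMatrix i j).det
      = (Matrix.of fun i j => c * a j * G i j).det := by
    congr 1; ext i j; exact h i j
  rw [Matrix.det_fin_three, Matrix.det_fin_three] at e
  simp [Matrix.minorMatrix] at e
  rw [Matrix.det_fin_three]
  linear_combination e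

end IsScaledHom

end Matrices

end DiagLieLattice

/-! ### Virtual endomorphisms of index `p`. -/

namespace VirtualEndomorphism

variable {p : ℕ} [Fact p.Prime] {L : Type*} [LieRing L] [LieAlgebra ℤ_[p] L]

theorem smul_mem_domain (φ : VirtualEndomorphism p L) (h : φ.index = p) (x : L) :
    (p : ℤ_[p]) • x ∈ φ.domain := by
  have := φ.domain.toSubmodule.toAddSubgroup.nsmul_index_mem x
  change φ.index • x ∈ _ at this
  rw [h] at this
  rw [Nat.cast_smul_eq_nsmul]
  exact this

/-- The quotient by the domain has prime order, so the class of `x` generates it. -/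
theorem exists_sub_smul_mem_domain (φ : VirtualEndomorphism p L) (h : φ.index = p) {x : L}
    (hx : x ∉ φ.domain) (y : L) : ∃ c : ℤ_[p], y - c • x ∈ φ.domain := by
  have hx' : (QuotientAddGroup.mk x : L ⧸ φ.domain.toSubmodule.toAddSubgroup) ≠ 0 := by
    rw [Ne, QuotientAddGroup.eq_zero_iff]; exact hx
  have htop := zmultiples_eq_top_of_prime_card (p := p) h hx'
  have hy : (QuotientAddGroup.mk y : L ⧸ φ.domain.toSubmodule.toAddSubgroup) ∈
      AddSubgroup.zmultiples (QuotientAddGroup.mk x : L ⧸ φ.domain.toSubmodule.toAddSubgroup) := by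
    rw [htop]; trivial
  obtain ⟨n, hn⟩ := AddSubgroup.mem_zmultiples_iff.1 hy
  refine ⟨n, ?_⟩
  rw [← QuotientAddGroup.mk_zsmul, QuotientAddGroup.eq] at hn
  rw [Int.cast_smul_eq_zsmul, sub_eq_neg_add]
  exact hn

/-- The linear map `x ↦ φ (p x)`. -/
noncomputable def scaledHom (φ : VirtualEndomorphism p L) (h : φ.index = p) : L →ₗ[ℤ_[p]] L where
  toFun x := φ.hom ⟨(p : ℤ_[p]) • x, φ.smul_mem_domain h x⟩
  map_add' x y := by
    rw [← map_add]; congr 1; ext; simp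
  map_smul' r x := by
    rw [RingHom.id_apply, ← map_smul]; congr 1; ext; exact smul_comm _ _ _

theorem scaledHom_lie (φ : VirtualEndomorphism p L) (h : φ.index = p) (x y : L) :
    ⁅φ.scaledHom h x, φ.scaledHom h y⁆ = (p : ℤ_[p]) • φ.scaledHom h ⁅x, y⁆ := by
  change ⁅φ.hom _, φ.hom _⁆ = (p : ℤ_[p]) • φ.hom _
  rw [← LieHom.map_lie, ← map_smul]
  congr 1
  ext
  simp

theorem scaledHom_of_mem (φ : VirtualEndomorphism p L) (h : φ.index = p) (x : φ.domain) :
    φ.scaledHom h x = (p : ℤ_[p]) • φ.hom x := by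
  change φ.hom _ = _
  rw [← map_smul]
  rfl

end VirtualEndomorphism

/-! ### Necessary conditions for self-similarity of index `p`. -/

namespace DiagLieLattice

/-- The element with given coordinates. -/
def ofCoords {R : Type*} (a v : Fin 3 → R) : DiagLieLattice a := v

theorem ofCoords_apply {R : Type*} (a v : Fin 3 → R) (i : Fin 3) : ofCoords a v i = v i := rfl

/-- The ideal of the vectors with `i`-th coordinate divisible by `r i`. -/
def coordIdeal {R : Type*} [CommRing R] (a r : Fin 3 → R)
    (h : ∀ i j k, i ≠ j → r i ∣ a i * (r j * k)) : LieIdeal R (DiagLieLattice a) where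
  carrier := {v | ∀ i, r i ∣ v i}
  add_mem' hv hw i := dvd_add (hv i) (hw i)
  zero_mem' i := dvd_zero _
  smul_mem' c v hv i := Dvd.dvd.mul_left (hv i) c
  lie_mem := by
    intro v w hw i
    obtain ⟨k0, h0⟩ := hw 0
    obtain ⟨k1, h1⟩ := hw 1
    obtain ⟨k2, h2⟩ := hw 2
    fin_cases i
    · change r 0 ∣ a 0 * (v 1 * w 2 - v 2 * w 1)
      rw [h2, h1]
      convert (h 0 2 (v 1 * k2) (by decide)).sub (h 0 1 (v 2 * k1) (by decide)) using 1; ring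
    · change r 1 ∣ a 1 * (v 2 * w 0 - v 0 * w 2)
      rw [h0, h2]
      convert (h 1 0 (v 2 * k0) (by decide)).sub (h 1 2 (v 0 * k2) (by decide)) using 1; ring
    · change r 2 ∣ a 2 * (v 0 * w 1 - v 1 * w 0)
      rw [h0, h1]
      convert (h 2 1 (v 0 * k1) (by decide)).sub (h 2 0 (v 1 * k0) (by decide)) using 1; ring

theorem mem_coordIdeal {R : Type*} [CommRing R] {a r : Fin 3 → R}
    {h : ∀ i j k, i ≠ j → r i ∣ a i * (r j * k)} {v : DiagLieLattice a} :
    v ∈ coordIdeal a r h ↔ ∀ i, r i ∣ v i := Iff.rfl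

theorem apply_eq_sum {R : Type*} [CommRing R] {a a' : Fin 3 → R}
    (g : DiagLieLattice a →ₗ[R] DiagLieLattice a') (v : DiagLieLattice a) (i : Fin 3) :
    g v i = ∑ j, g (stdBasis a j) i * v j := by
  conv_lhs => rw [← (stdBasis a).sum_repr v, Fin.sum_univ_three]
  simp only [map_add, map_smul, add_apply, smul_apply, Fin.sum_univ_three]
  change v 0 * _ + v 1 * _ + v 2 * _ = _
  ring

variable {p : ℕ} [Fact p.Prime]

/-- `G` is the matrix of `x ↦ φ (p x)`. The second clause says that `G` has rank at most 1 modulo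
`p`. The third is simplicity tested on the ideals of vectors with `k`-th coordinate divisible by `p
^ (1 + n k)`: on such an ideal `φ` acts as `G / p`. -/
theorem exists_isScaledHom_of_isSelfSimilar {a : Fin 3 → ℤ_[p]}
    (h : IsSelfSimilarOfIndex p (DiagLieLattice a) p) :
    ∃ G : Matrix (Fin 3) (Fin 3) ℤ_[p], IsScaledHom (p : ℤ_[p]) a a G ∧
      (∀ j k, (∀ i, (p : ℤ_[p]) ∣ G i j) ∨ ∃ c, ∀ i, (p : ℤ_[p]) ∣ G i k - c * G i j) ∧
      ∀ n : Fin 3 → ℕ, (∀ k, (p : ℤ_[p]) ^ n k ∣ a k) →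
        ¬ ∀ k j, (p : ℤ_[p]) ^ (1 + n k) ∣ G k j * (p : ℤ_[p]) ^ n j := by
  obtain ⟨-, φ, hsimple, hφ⟩ := h
  have hp0 : (p : ℤ_[p]) ≠ 0 := PadicInt.prime_p.ne_zero
  refine ⟨_, isScaledHom_of_map_lie (φ.scaledHom hφ) (φ.scaledHom_lie hφ), ?_, ?_⟩
  · have key : ∀ x ∈ φ.domain, ∀ i, (p : ℤ_[p]) ∣ φ.scaledHom hφ x i := by
      intro x hx i
      rw [φ.scaledHom_of_mem hφ ⟨x, hx⟩]
      exact Dvd.intro _ rfl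
    intro j k
    by_cases hj : stdBasis a j ∈ φ.domain
    · exact Or.inl fun i => key _ hj i
    · obtain ⟨c, hc⟩ := φ.exists_sub_smul_mem_domain hφ hj (stdBasis a k)
      refine Or.inr ⟨c, fun i => ?_⟩
      have := key _ hc i
      rw [map_sub, map_smul] at this
      exact this
  · intro n hn hG
    have hr : ∀ i j k, i ≠ j → (p : ℤ_[p]) ^ (1 + n i) ∣ a i * ((p : ℤ_[p]) ^ (1 + n j) * k) := by
      intro i j k _
      obtain ⟨t, ht⟩ := hn i
      exact ⟨t * (p : ℤ_[p]) ^ n j * k, by rw [ht]; ring⟩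
    have hinv : φ.IsInvariant (coordIdeal a (fun i => (p : ℤ_[p]) ^ (1 + n i)) hr) := by
      -- The extra 1 in the exponents puts the ideal inside `pL`, hence inside the domain.
      constructor
      · intro x hx
        choose y hy using fun i => (mem_coordIdeal.1 hx) i
        have : x = (p : ℤ_[p]) • ofCoords a fun i => (p : ℤ_[p]) ^ n i * y i := by
          funext i
          rw [smul_apply, ofCoords_apply, hy i]; ring
        rw [this]
        exact φ.smul_mem_domain hφ _
      · intro x hx i
        have hx' := mem_coordIdeal.1 hx
        have e := congrFun (φ.scaledHom_of_mem hφ x) i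
        rw [smul_apply, apply_eq_sum] at e
        rw [← mul_dvd_mul_iff_left hp0, ← e]
        refine Finset.dvd_sum fun j _ => ?_
        obtain ⟨t, ht⟩ := hG i j
        obtain ⟨y, hy⟩ := hx' j
        rw [Matrix.of_apply] at ht
        refine ⟨t * y, ?_⟩
        simp only at hy ⊢
        rw [hy]
        linear_combination (p : ℤ_[p]) * y * ht
    have hbot := hsimple _ hinv
    have hmem : ofCoords a (fun i => (p : ℤ_[p]) ^ (1 + n i)) ∈
        coordIdeal a (fun i => (p : ℤ_[p]) ^ (1 + n i)) hr := fun i => dvd_rfl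
    rw [hbot, LieSubmodule.mem_bot] at hmem
    exact pow_ne_zero _ hp0 (congrFun hmem 0)

namespace IsScaledHom

variable {a : Fin 3 → ℤ_[p]} {G : Matrix (Fin 3) (Fin 3) ℤ_[p]}

/-- Rank at most 1 modulo `p` makes all `2 × 2` minors divisible by `p`, and this factor cancels the
scalar `p` in the relation for `G`. -/
theorem dvd_mul_entry (h : IsScaledHom (p : ℤ_[p]) a a G)
    (hrank : ∀ j k, (∀ i, (p : ℤ_[p]) ∣ G i j) ∨ ∃ c, ∀ i, (p : ℤ_[p]) ∣ G i k - c * G i j)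
    (i j : Fin 3) : a i ∣ a j * G i j := by
  have hminor : ∀ j k i l, (p : ℤ_[p]) ∣ G i j * G l k - G l j * G i k := by
    intro j k i l
    rcases hrank j k with hj | ⟨c, hc⟩
    · exact ((hj i).mul_right _).sub ((hj l).mul_right _)
    · convert ((hc l).mul_left (G i j)).sub ((hc i).mul_left (G l j)) using 1; ring
  have hp0 : (p : ℤ_[p]) ≠ 0 := PadicInt.prime_p.ne_zero
  have hij : (p : ℤ_[p]) ∣ G.minorMatrix i j := by
    fin_cases i <;> fin_cases j <;> exact hminor _ _ _ _
  obtain ⟨t, ht⟩ := hij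
  refine ⟨t, mul_left_cancel₀ hp0 ?_⟩
  have := h i j
  rw [ht] at this
  linear_combination -this

/-- By `det_sq` the determinant is 0 or `p ^ 3`, so `mul_form` gives the value of the form on column
`j` as `p ^ 2 * formCoeff a j` times `G.det / p ^ 3`. -/
theorem sq_mul_formCoeff_dvd (h : IsScaledHom (p : ℤ_[p]) a a G) (ha : ∀ i, a i ≠ 0)
    (j : Fin 3) : (p : ℤ_[p]) ^ 2 * formCoeff a j ∣
      formCoeff a 0 * G 0 j ^ 2 + formCoeff a 1 * G 1 j ^ 2 + formCoeff a 2 * G 2 j ^ 2 := by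
  have hp0 : (p : ℤ_[p]) ≠ 0 := PadicInt.prime_p.ne_zero
  have hΔ : a 0 * a 1 * a 2 ≠ 0 := mul_ne_zero (mul_ne_zero (ha 0) (ha 1)) (ha 2)
  have hdet : (p : ℤ_[p]) ^ 3 ∣ G.det := by
    by_cases h0 : G.det = 0
    · rw [h0]; exact dvd_zero _
    · refine ⟨1, mul_left_cancel₀ hΔ (mul_right_cancel₀ h0 ?_)⟩
      linear_combination h.det_sq
  obtain ⟨e, he⟩ := hdet
  refine ⟨e, mul_left_cancel₀ (mul_ne_zero hp0 (ha j)) ?_⟩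
  rw [h.mul_form j, he]
  fin_cases j <;> simp [formCoeff] <;> ring

end IsScaledHom

end DiagLieLattice

namespace Prime

variable {R : Type*} [CommRing R] {π : R}

theorem dvd_of_sq_dvd_unit_mul_sq_add (hπ : Prime π) {u x y : R} (hu : ¬ π ∣ u)
    (h : π ^ 2 ∣ u * x ^ 2 + π * y) : π ∣ x := by
  have h1 : π ∣ u * x ^ 2 := by
    rw [← dvd_add_left (dvd_mul_right π y)]
    exact (dvd_pow_self π two_ne_zero).trans h
  exact hπ.dvd_of_dvd_pow ((hπ.dvd_or_dvd h1).resolve_left hu)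

/-- If `π ^ m * u * x ^ 2` is divisible by `π ^ 2`, where `m` is positive, then so is
`π ^ m * x`. -/
theorem sq_dvd_pow_mul [IsDomain R] (hπ : Prime π) {u x y : R} (hu : ¬ π ∣ u) {m : ℕ} (hm : 0 < m)
    (h : π ^ 2 ∣ π ^ m * (u * x ^ 2) + π ^ 2 * y) : π ^ 2 ∣ π ^ m * x := by
  rcases Nat.lt_or_ge m 2 with h1 | h1
  · obtain rfl : m = 1 := by omega
    rw [dvd_add_left (dvd_mul_right _ y), pow_one, pow_two, mul_dvd_mul_iff_left hπ.ne_zero] at h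
    rw [pow_one, pow_two]
    exact mul_dvd_mul_left _
      (hπ.dvd_of_dvd_pow ((hπ.dvd_or_dvd h).resolve_left hu))
  · exact (pow_dvd_pow π h1).mul_right x

end Prime

/-! ### The lattices that are not self-similar of index `p`. -/

namespace DiagLieLattice

variable {p : ℕ} [Fact p.Prime]

theorem pow_dvd_of_mul_dvd {u v x : ℤ_[p]} (hv : IsUnit v) {s m : ℕ}
    (h : u * (p : ℤ_[p]) ^ (s + m) ∣ v * (p : ℤ_[p]) ^ s * x) : (p : ℤ_[p]) ^ m ∣ x := by
  have hp : (p : ℤ_[p]) ^ s ≠ 0 := pow_ne_zero _ PadicInt.prime_p.ne_zero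
  have h1 : (p : ℤ_[p]) ^ s * (p : ℤ_[p]) ^ m ∣ (p : ℤ_[p]) ^ s * (v * x) := by
    refine (Dvd.intro_left u ?_).trans h |>.trans (Dvd.intro 1 ?_)
    · rw [pow_add]
    · ring
  rw [mul_dvd_mul_iff_left hp] at h1
  exact (hv.dvd_mul_left).1 h1

theorem not_isSelfSimilar_of_lt_of_lt {s₀ s₁ s₂ : ℕ} (h₀₁ : s₀ < s₁) (h₁₂ : s₁ < s₂)
    {u₀ u₁ u₂ : ℤ_[p]} (hu₀ : IsUnit u₀) (hu₁ : IsUnit u₁) (hu₂ : IsUnit u₂) :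
    ¬ IsSelfSimilarOfIndex p (DiagLieLattice
      ![u₀ * (p : ℤ_[p]) ^ s₀, u₁ * (p : ℤ_[p]) ^ s₁, u₂ * (p : ℤ_[p]) ^ s₂]) p := by
  intro hss
  obtain ⟨G, hG, hrank, hideal⟩ := exists_isScaledHom_of_isSelfSimilar hss
  have hπ : Prime (p : ℤ_[p]) := PadicInt.prime_p
  have hd := hG.dvd_mul_entry hrank
  have hN := hG.sq_mul_formCoeff_dvd (by
    intro i; fin_cases i <;> simp [hu₀.ne_zero, hu₁.ne_zero, hu₂.ne_zero, hπ.ne_zero])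
  have hN0 := hN 0
  have hN1 := hN 1
  have hN2 := hN 2
  have hd10 := hd 1 0
  have hd20 := hd 2 0
  have hd21 := hd 2 1
  obtain ⟨m, rfl⟩ := Nat.exists_eq_add_of_lt h₀₁
  obtain ⟨n, rfl⟩ := Nat.exists_eq_add_of_lt h₁₂
  simp only [formCoeff, Matrix.cons_val_zero, Matrix.cons_val_one, Matrix.cons_val]
    at hN0 hN1 hN2 hd10 hd20 hd21
  obtain ⟨x, hx⟩ := pow_dvd_of_mul_dvd (m := m + 1) hu₀ (by simpa only [add_assoc] using hd10)
  obtain ⟨y, hy⟩ := pow_dvd_of_mul_dvd (m := m + 1 + n + 1) hu₀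
    (by simpa only [add_assoc] using hd20)
  obtain ⟨z, hz⟩ := pow_dvd_of_mul_dvd (s := s₀ + m + 1) (m := n + 1) hu₁ hd21
  rw [hx, hy] at hN0
  rw [hz] at hN1
  have hc' : ∀ k, (p : ℤ_[p]) ^ k ≠ 0 := fun k => pow_ne_zero _ hπ.ne_zero
  have hn : ∀ {w : ℤ_[p]}, IsUnit w → ¬ (p : ℤ_[p]) ∣ w :=
    fun {w} hw => (PadicInt.isUnit_iff_not_dvd w).1 hw
  -- The form on each column, divided by the power of `p` in its diagonal coefficient. Each diagonal
  -- entry of `G` then appears with a unit coefficient, modulo `p`.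
  have hM0 : (p : ℤ_[p]) ^ 2 ∣ u₁ * u₂ * G 0 0 ^ 2 + p * ((p : ℤ_[p]) ^ m *
      (u₀ * (u₂ * x ^ 2 + p * (p : ℤ_[p]) ^ n * (u₁ * y ^ 2)))) := by
    rw [← mul_dvd_mul_iff_left (hc' (s₀ + m + 1 + s₀ + m + 1 + n + 1))]
    refine (Dvd.intro (u₁ * u₂) ?_).trans (hN0.trans (Dvd.intro 1 ?_)) <;> ring
  have hM1 : (p : ℤ_[p]) ^ 2 ∣ u₀ * u₂ * G 1 1 ^ 2 + p * ((p : ℤ_[p]) ^ m * (u₁ * u₂ * G 0 1 ^ 2)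
      + (p : ℤ_[p]) ^ n * (u₀ * u₁ * z ^ 2)) := by
    rw [← mul_dvd_mul_iff_left (hc' (s₀ + s₀ + m + 1 + n + 1))]
    refine (Dvd.intro (u₀ * u₂) ?_).trans (hN1.trans (Dvd.intro 1 ?_)) <;> ring
  have hM2 : (p : ℤ_[p]) ^ 2 ∣ u₀ * u₁ * G 2 2 ^ 2 + p * ((p : ℤ_[p]) ^ n *
      (u₀ * u₂ * G 1 2 ^ 2 + p * (p : ℤ_[p]) ^ m * (u₁ * u₂ * G 0 2 ^ 2))) := by
    rw [← mul_dvd_mul_iff_left (hc' (s₀ + s₀ + m + 1))]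
    refine (Dvd.intro (u₀ * u₁) ?_).trans (hN2.trans (Dvd.intro 1 ?_)) <;> ring
  have h00 := hπ.dvd_of_sq_dvd_unit_mul_sq_add (hn (hu₁.mul hu₂)) hM0
  have h11 := hπ.dvd_of_sq_dvd_unit_mul_sq_add (hn (hu₀.mul hu₂)) hM1
  have h22 := hπ.dvd_of_sq_dvd_unit_mul_sq_add (hn (hu₀.mul hu₁)) hM2
  have h10 : (p : ℤ_[p]) ^ 2 ∣ G 1 0 := by
    obtain ⟨t, ht⟩ := h00
    rw [hx]
    refine hπ.sq_dvd_pow_mul (hn (hu₀.mul hu₂)) m.succ_pos (y := u₁ * u₂ * t ^ 2 +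
      (p : ℤ_[p]) ^ m * (p : ℤ_[p]) ^ n * (u₀ * u₁ * y ^ 2)) ?_
    rw [ht] at hM0
    convert hM0 using 1; ring
  have h20 : (p : ℤ_[p]) ^ 2 ∣ G 2 0 := by
    rw [hy]; exact (pow_dvd_pow _ (by omega)).mul_right _
  have h21 : (p : ℤ_[p]) ∣ G 2 1 := by
    rw [hz]; exact (dvd_pow_self _ (by omega)).mul_right _
  -- `G 1 2` is the only entry that can obstruct invariance for `n = (0, 1, 1)`. If it is not
  -- divisible by `p`, the rank condition makes column 1 a multiple of column 2 modulo `p`; as `p ∣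
  -- G 1 1`, column 1 vanishes modulo `p`, and `n = (0, 0, 1)` works.
  by_cases h12 : (p : ℤ_[p]) ∣ G 1 2
  · refine hideal ![0, 1, 1] ?_ ?_
    · intro k
      fin_cases k <;> simp <;> exact (dvd_pow_self _ (by omega)).mul_left _
    · intro k j
      fin_cases k <;> fin_cases j <;> simp [pow_two] at h10 h20 ⊢ <;>
        first | assumption | exact mul_dvd_mul_right (by assumption) _
  · rcases hrank 2 1 with h | ⟨c, hc1⟩
    · exact h12 (h 1)
    have hcp : (p : ℤ_[p]) ∣ c := by
      have h3 : (p : ℤ_[p]) ∣ c * G 1 2 := (dvd_sub_right h11).1 (hc1 1)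
      exact (hπ.dvd_or_dvd h3).resolve_right h12
    have h01 : (p : ℤ_[p]) ∣ G 0 1 := (dvd_sub_left (hcp.mul_right _)).1 (hc1 0)
    have h21' : (p : ℤ_[p]) ^ 2 ∣ G 2 1 := by
      obtain ⟨t, ht⟩ := h11
      obtain ⟨t', ht'⟩ := h01
      rw [hz]
      refine hπ.sq_dvd_pow_mul (hn (hu₀.mul hu₁)) n.succ_pos (y := u₀ * u₂ * t ^ 2 +
        p * (p : ℤ_[p]) ^ m * (u₁ * u₂ * t' ^ 2)) ?_
      rw [ht, ht'] at hM1
      convert hM1 using 1; ring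
    refine hideal ![0, 0, 1] ?_ ?_
    · intro k
      fin_cases k <;> simp
      exact (dvd_pow_self _ (by omega)).mul_left _
    · intro k j
      have h10' : (p : ℤ_[p]) ∣ G 1 0 := (dvd_pow_self _ two_ne_zero).trans h10
      fin_cases k <;> fin_cases j <;> simp [pow_two] at h10 h20 h21' ⊢ <;>
        first | assumption | exact mul_dvd_mul_right (by assumption) _

/-- Anisotropy of `X ^ 2 - ρ Y ^ 2` modulo `p` forces the first two entries of columns 0 and 1 to be
divisible by `p`; their last entries are then divisible by `p ^ 2`. -/
theorem not_isSelfSimilar_of_eq_of_lt {ρ : ℤ_[p]} (hρ : ¬ IsSquare (PadicInt.toZMod ρ))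
    (hρu : IsUnit ρ) {s₀ s₂ : ℕ} (h₀₂ : s₀ < s₂) :
    ¬ IsSelfSimilarOfIndex p (DiagLieLattice
      ![(p : ℤ_[p]) ^ s₀, -(ρ * (p : ℤ_[p]) ^ s₀), (p : ℤ_[p]) ^ s₂]) p := by
  intro hss
  obtain ⟨G, hG, hrank, hideal⟩ := exists_isScaledHom_of_isSelfSimilar hss
  have hπ : Prime (p : ℤ_[p]) := PadicInt.prime_p
  have hd := hG.dvd_mul_entry hrank
  have hN := hG.sq_mul_formCoeff_dvd (by
    intro i; fin_cases i <;> simp [hρu.ne_zero, hπ.ne_zero])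
  obtain ⟨n, rfl⟩ := Nat.exists_eq_add_of_lt h₀₂
  have hc' : ∀ k, (p : ℤ_[p]) ^ k ≠ 0 := fun k => pow_ne_zero _ hπ.ne_zero
  have hn : ∀ {w : ℤ_[p]}, IsUnit w → ¬ (p : ℤ_[p]) ∣ w :=
    fun {w} hw => (PadicInt.isUnit_iff_not_dvd w).1 hw
  have key : ∀ j : Fin 3, (p : ℤ_[p]) ^ (n + 1) ∣ G 2 j →
      (p : ℤ_[p]) ^ (n + 3) ∣ (p : ℤ_[p]) ^ (n + 1) * (G 1 j ^ 2 - ρ * G 0 j ^ 2)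
        + (-ρ) * G 2 j ^ 2 →
      (p : ℤ_[p]) ∣ G 0 j ∧ (p : ℤ_[p]) ∣ G 1 j ∧ (p : ℤ_[p]) ^ 2 ∣ G 2 j := by
    rintro j ⟨x, hx⟩ h
    rw [hx] at h ⊢
    have h2 : (p : ℤ_[p]) ^ 2 ∣ (G 1 j ^ 2 - ρ * G 0 j ^ 2)
        + (p : ℤ_[p]) ^ (n + 1) * ((-ρ) * x ^ 2) := by
      rw [← mul_dvd_mul_iff_left (hc' (n + 1))]
      convert h using 1 <;> ring
    have h3 : (p : ℤ_[p]) ∣ G 1 j ^ 2 - ρ * G 0 j ^ 2 := by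
      rw [← dvd_add_left ((dvd_pow_self _ n.succ_ne_zero).mul_right ((-ρ) * x ^ 2))]
      exact (dvd_pow_self _ two_ne_zero).trans h2
    obtain ⟨h1, h0⟩ := PadicInt.dvd_of_dvd_sq_sub_mul_sq hρ h3
    refine ⟨h0, h1, ?_⟩
    obtain ⟨t, ht⟩ := h1
    obtain ⟨t', ht'⟩ := h0
    refine hπ.sq_dvd_pow_mul (hn hρu.neg) n.succ_pos (y := t ^ 2 - ρ * t' ^ 2) ?_
    rw [ht, ht'] at h2
    convert h2 using 1; ring
  have hlow : ∀ j : Fin 3, j ≠ 2 → (p : ℤ_[p]) ^ (n + 1) ∣ G 2 j := by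
    intro j hj
    have h := hd 2 j
    fin_cases j
    · exact pow_dvd_of_mul_dvd (u := 1) (v := 1) (s := s₀) isUnit_one (by
        simpa [add_assoc] using h)
    · exact pow_dvd_of_mul_dvd (u := 1) (v := -ρ) (s := s₀) hρu.neg (by
        simpa [add_assoc] using h)
    · exact absurd rfl hj
  have hform : ∀ j : Fin 3, j ≠ 2 → (p : ℤ_[p]) ^ (n + 3) ∣
      (p : ℤ_[p]) ^ (n + 1) * (G 1 j ^ 2 - ρ * G 0 j ^ 2) + (-ρ) * G 2 j ^ 2 := by
    intro j hj
    have h := hN j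
    simp only [formCoeff, Matrix.cons_val_zero, Matrix.cons_val_one, Matrix.cons_val] at h
    rw [← mul_dvd_mul_iff_left (hc' (2 * s₀))]
    fin_cases j
    · refine (Dvd.intro (-ρ) ?_).trans (h.trans (Dvd.intro 1 ?_)) <;> simp <;> ring
    · refine (Dvd.intro 1 ?_).trans (h.trans (Dvd.intro 1 ?_)) <;> simp <;> ring
    · exact absurd rfl hj
  obtain ⟨h00, h10, h20⟩ := key 0 (hlow 0 (by decide)) (hform 0 (by decide))
  obtain ⟨h01, h11, h21⟩ := key 1 (hlow 1 (by decide)) (hform 1 (by decide))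
  have hN2 := hN 2
  simp only [formCoeff, Matrix.cons_val_zero, Matrix.cons_val_one, Matrix.cons_val] at hN2
  have hM2 : (p : ℤ_[p]) ^ 2 ∣ (-ρ) * G 2 2 ^ 2 + p * ((p : ℤ_[p]) ^ n *
      (G 1 2 ^ 2 - ρ * G 0 2 ^ 2)) := by
    rw [← mul_dvd_mul_iff_left (hc' (2 * s₀))]
    refine (Dvd.intro (-ρ) ?_).trans (hN2.trans (Dvd.intro 1 ?_)) <;> ring
  have h22 := hπ.dvd_of_sq_dvd_unit_mul_sq_add (hn hρu.neg) hM2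
  refine hideal ![0, 0, 1] ?_ ?_
  · intro k
    fin_cases k <;> simp
  · intro k j
    fin_cases k <;> fin_cases j <;> simp [pow_two] at h20 h21 ⊢ <;>
      first | assumption | exact mul_dvd_mul_right (by assumption) _

/-- Here anisotropy concerns the last two coordinates: it makes them divisible by `p` in columns 1
and 2. In column 0 they must be divisible by `p ^ 2`. -/
theorem not_isSelfSimilar_of_lt_of_eq {ρ : ℤ_[p]} (hρ : ¬ IsSquare (PadicInt.toZMod ρ))
    (hρu : IsUnit ρ) {s₀ s₁ : ℕ} (h₀₁ : s₀ < s₁) :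
    ¬ IsSelfSimilarOfIndex p (DiagLieLattice
      ![(p : ℤ_[p]) ^ s₀, (p : ℤ_[p]) ^ s₁, -(ρ * (p : ℤ_[p]) ^ s₁)]) p := by
  intro hss
  obtain ⟨G, hG, hrank, hideal⟩ := exists_isScaledHom_of_isSelfSimilar hss
  have hπ : Prime (p : ℤ_[p]) := PadicInt.prime_p
  have hd := hG.dvd_mul_entry hrank
  have hN := hG.sq_mul_formCoeff_dvd (by
    intro i; fin_cases i <;> simp [hρu.ne_zero, hπ.ne_zero])
  obtain ⟨m, rfl⟩ := Nat.exists_eq_add_of_lt h₀₁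
  have hc' : ∀ k, (p : ℤ_[p]) ^ k ≠ 0 := fun k => pow_ne_zero _ hπ.ne_zero
  have hn : ∀ {w : ℤ_[p]}, IsUnit w → ¬ (p : ℤ_[p]) ∣ w :=
    fun {w} hw => (PadicInt.isUnit_iff_not_dvd w).1 hw
  have hright : ∀ j : Fin 3, j ≠ 0 → (p : ℤ_[p]) ∣ G 1 j ∧ (p : ℤ_[p]) ∣ G 2 j := by
    intro j hj
    have h := hN j
    simp only [formCoeff, Matrix.cons_val_zero, Matrix.cons_val_one, Matrix.cons_val] at h
    have h2 : (p : ℤ_[p]) ^ 2 ∣ (G 2 j ^ 2 - ρ * G 1 j ^ 2)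
        + p * ((p : ℤ_[p]) ^ m * (-ρ * G 0 j ^ 2)) := by
      rw [← mul_dvd_mul_iff_left (hc' (2 * s₀ + m + 1))]
      fin_cases j
      · exact absurd rfl hj
      · refine (Dvd.intro (-ρ) ?_).trans (h.trans (Dvd.intro 1 ?_)) <;> simp <;> ring
      · refine (Dvd.intro 1 ?_).trans (h.trans (Dvd.intro 1 ?_)) <;> simp <;> ring
    have h3 : (p : ℤ_[p]) ∣ G 2 j ^ 2 - ρ * G 1 j ^ 2 := by
      rw [← dvd_add_left (Dvd.intro ((p : ℤ_[p]) ^ m * (-ρ * G 0 j ^ 2)) rfl)]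
      exact (dvd_pow_self _ two_ne_zero).trans h2
    exact (PadicInt.dvd_of_dvd_sq_sub_mul_sq hρ h3).symm
  obtain ⟨h11, h21⟩ := hright 1 (by decide)
  obtain ⟨h12, h22⟩ := hright 2 (by decide)
  obtain ⟨x, hx⟩ : (p : ℤ_[p]) ^ (m + 1) ∣ G 1 0 :=
    pow_dvd_of_mul_dvd (u := 1) (v := 1) (s := s₀) isUnit_one (by
        simpa [add_assoc] using hd 1 0)
  obtain ⟨y, hy⟩ : (p : ℤ_[p]) ^ (m + 1) ∣ G 2 0 :=
    pow_dvd_of_mul_dvd (u := -ρ) (v := 1) (s := s₀) isUnit_one (by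
        simpa [add_assoc] using hd 2 0)
  have hN0 := hN 0
  simp only [formCoeff, Matrix.cons_val_zero, Matrix.cons_val_one, Matrix.cons_val] at hN0
  rw [hx, hy] at hN0
  have hM0 : (p : ℤ_[p]) ^ 2 ∣ (-ρ) * G 0 0 ^ 2 + p * ((p : ℤ_[p]) ^ m *
      (y ^ 2 - ρ * x ^ 2)) := by
    rw [← mul_dvd_mul_iff_left (hc' (2 * s₀ + m + 1 + m + 1))]
    refine (Dvd.intro (-ρ) ?_).trans (hN0.trans (Dvd.intro 1 ?_)) <;> ring
  have h00 := hπ.dvd_of_sq_dvd_unit_mul_sq_add (hn hρu.neg) hM0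
  have hlow : (p : ℤ_[p]) ^ 2 ∣ G 1 0 ∧ (p : ℤ_[p]) ^ 2 ∣ G 2 0 := by
    rw [hx, hy]
    -- When `s₁ = s₀ + 1` the bound on the entries gives only one factor `p`; a second use of
    -- anisotropy supplies the other.
    rcases Nat.eq_zero_or_pos m with rfl | hm
    · obtain ⟨t, ht⟩ := h00
      rw [ht] at hM0
      have h3 : (p : ℤ_[p]) ∣ y ^ 2 - ρ * x ^ 2 := by
        rw [← mul_dvd_mul_iff_left hπ.ne_zero, ← pow_two,
          ← dvd_add_right (Dvd.intro ((-ρ) * t ^ 2) rfl)]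
        convert hM0 using 1; ring
      obtain ⟨h4, h5⟩ := PadicInt.dvd_of_dvd_sq_sub_mul_sq hρ h3
      rw [zero_add, pow_one, pow_two]
      exact ⟨mul_dvd_mul_left _ h5, mul_dvd_mul_left _ h4⟩
    · exact ⟨(pow_dvd_pow _ (by omega)).mul_right _, (pow_dvd_pow _ (by omega)).mul_right _⟩
  obtain ⟨h10, h20⟩ := hlow
  refine hideal ![0, 1, 1] ?_ ?_
  · intro k
    fin_cases k <;> simp
    exact (dvd_pow_self _ (by omega)).mul_left _
  · intro k j
    fin_cases k <;> fin_cases j <;> simp [pow_two] at h10 h20 ⊢ <;>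
      first | assumption | exact mul_dvd_mul_right (by assumption) _

end DiagLieLattice

/-! ### Self-similarity from a basis of `sl₂` type. -/

section SelfSimilar

variable {p : ℕ} [Fact p.Prime] {L : Type*} [LieRing L] [LieAlgebra ℤ_[p] L]

theorem PadicInt.eq_zero_of_forall_pow_dvd {x : ℤ_[p]} (h : ∀ n : ℕ, (p : ℤ_[p]) ^ n ∣ x) :
    x = 0 := by
  by_contra hx
  exact (FiniteMultiplicity.of_not_isUnit PadicInt.prime_p.not_isUnit hx).not_pow_dvd_of_multiplicity_lt
    (Nat.lt_succ_self _) (h _)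

namespace SplitTriple

variable (b : Module.Basis (Fin 3) ℤ_[p] L) {α γ : ℤ_[p]}

theorem eq_sum_coord (v : L) :
    v = b.coord 0 v • b 0 + b.coord 1 v • b 1 + b.coord 2 v • b 2 := by
  conv_lhs => rw [← b.sum_repr v, Fin.sum_univ_three]
  rfl

theorem coord_comb (x y z : ℤ_[p]) :
    b.coord 0 (x • b 0 + y • b 1 + z • b 2) = x ∧ b.coord 1 (x • b 0 + y • b 1 + z • b 2) = y ∧
      b.coord 2 (x • b 0 + y • b 1 + z • b 2) = z := by
  refine ⟨?_, ?_, ?_⟩ <;> simp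

theorem lie_comb (h01 : ⁅b 0, b 1⁆ = -(α • b 1)) (h02 : ⁅b 0, b 2⁆ = α • b 2)
    (h12 : ⁅b 1, b 2⁆ = γ • b 0) (x y z x' y' z' : ℤ_[p]) :
    ⁅x • b 0 + y • b 1 + z • b 2, x' • b 0 + y' • b 1 + z' • b 2⁆ =
      (γ * (y * z' - z * y')) • b 0 + (-α * (x * y' - y * x')) • b 1 +
        (α * (x * z' - z * x')) • b 2 := by
  have h10 : ⁅b 1, b 0⁆ = α • b 1 := by rw [← lie_skew, h01, neg_neg]
  have h20 : ⁅b 2, b 0⁆ = -(α • b 2) := by rw [← lie_skew, h02]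
  have h21 : ⁅b 2, b 1⁆ = -(γ • b 0) := by rw [← lie_skew, h12]
  simp only [lie_add, add_lie, lie_smul, smul_lie, lie_self, h01, h02, h12, h10, h20, h21]
  module

theorem coord_lie (h01 : ⁅b 0, b 1⁆ = -(α • b 1)) (h02 : ⁅b 0, b 2⁆ = α • b 2)
    (h12 : ⁅b 1, b 2⁆ = γ • b 0) (v w : L) :
    b.coord 0 ⁅v, w⁆ = γ * (b.coord 1 v * b.coord 2 w - b.coord 2 v * b.coord 1 w) ∧
    b.coord 1 ⁅v, w⁆ = -α * (b.coord 0 v * b.coord 1 w - b.coord 1 v * b.coord 0 w) ∧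
    b.coord 2 ⁅v, w⁆ = α * (b.coord 0 v * b.coord 2 w - b.coord 2 v * b.coord 0 w) := by
  have e := lie_comb b h01 h02 h12 (b.coord 0 v) (b.coord 1 v) (b.coord 2 v)
    (b.coord 0 w) (b.coord 1 w) (b.coord 2 w)
  rw [← eq_sum_coord b v, ← eq_sum_coord b w] at e
  rw [e]
  exact coord_comb b _ _ _

/-- The subalgebra of the elements whose coordinate along `b 1` is divisible by `p`. -/
noncomputable def domain (h01 : ⁅b 0, b 1⁆ = -(α • b 1)) (h02 : ⁅b 0, b 2⁆ = α • b 2)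
    (h12 : ⁅b 1, b 2⁆ = γ • b 0) : LieSubalgebra ℤ_[p] L where
  carrier := {v | (p : ℤ_[p]) ∣ b.coord 1 v}
  add_mem' {v w} hv hw := by
    simp only [Set.mem_ofPred_eq, map_add] at *; exact dvd_add hv hw
  zero_mem' := by simp only [Set.mem_ofPred_eq, map_zero, dvd_zero]
  smul_mem' c v hv := by
    simp only [Set.mem_ofPred_eq, map_smul, smul_eq_mul] at *; exact hv.mul_left c
  lie_mem' {v w} hv hw := by
    change (p : ℤ_[p]) ∣ b.coord 1 ⁅v, w⁆
    rw [(coord_lie b h01 h02 h12 v w).2.1]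
    exact ((Dvd.dvd.mul_left hw _).sub (Dvd.dvd.mul_right hv _)).mul_left _

section

variable (h01 : ⁅b 0, b 1⁆ = -(α • b 1)) (h02 : ⁅b 0, b 2⁆ = α • b 2)
  (h12 : ⁅b 1, b 2⁆ = γ • b 0)

/-- The coordinate along `b 1`, divided by `p`. -/
noncomputable def quot (v : domain b h01 h02 h12) : ℤ_[p] := Classical.choose v.2

theorem mul_quot (v : domain b h01 h02 h12) :
    (p : ℤ_[p]) * quot b h01 h02 h12 v = b.coord 1 (v : L) :=
  (Classical.choose_spec v.2).symm

/-- The morphism dividing the coordinate along `b 1` by `p` and multiplying that along `b 2`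
by `p`. -/
noncomputable def hom : domain b h01 h02 h12 →ₗ⁅ℤ_[p]⁆ L where
  toFun v := b.coord 0 (v : L) • b 0 + quot b h01 h02 h12 v • b 1
    + ((p : ℤ_[p]) * b.coord 2 (v : L)) • b 2
  map_add' v w := by
    have : quot b h01 h02 h12 (v + w) = quot b h01 h02 h12 v + quot b h01 h02 h12 w := by
      apply mul_left_cancel₀ (PadicInt.prime_p (p := p)).ne_zero
      rw [mul_add, mul_quot, mul_quot, mul_quot, ← map_add]; rfl
    rw [this, show ((v + w : domain b h01 h02 h12) : L) = v + w from rfl, map_add, map_add]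
    module
  map_smul' r v := by
    have : quot b h01 h02 h12 (r • v) = r * quot b h01 h02 h12 v := by
      apply mul_left_cancel₀ (PadicInt.prime_p (p := p)).ne_zero
      rw [mul_left_comm, mul_quot, mul_quot, ← smul_eq_mul, ← map_smul]; rfl
    rw [this, show ((r • v : domain b h01 h02 h12) : L) = r • (v : L) from rfl, map_smul, map_smul,
      RingHom.id_apply]
    simp only [smul_eq_mul]
    module
  map_lie' {v w} := by
    obtain ⟨e0, e1, e2⟩ := coord_lie b h01 h02 h12 (v : L) (w : L)
    have : quot b h01 h02 h12 ⁅v, w⁆ = -α * (b.coord 0 (v : L) * quot b h01 h02 h12 w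
        - quot b h01 h02 h12 v * b.coord 0 (w : L)) := by
      apply mul_left_cancel₀ (PadicInt.prime_p (p := p)).ne_zero
      rw [mul_quot, LieSubalgebra.coe_bracket, e1, ← mul_quot b h01 h02 h12 v,
        ← mul_quot b h01 h02 h12 w]
      ring
    simp only [this, LieSubalgebra.coe_bracket]
    rw [lie_comb b h01 h02 h12, e0, e2, ← mul_quot b h01 h02 h12 v,
        ← mul_quot b h01 h02 h12 w]
    module

theorem smul_mem_domain (v : L) : (p : ℤ_[p]) • v ∈ domain b h01 h02 h12 := by
  change (p : ℤ_[p]) ∣ b.coord 1 ((p : ℤ_[p]) • v)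
  rw [map_smul]; exact dvd_mul_right _ _

/-- Multiplication by `p` embeds `L` into the domain. -/
theorem finrank_domain : Module.finrank ℤ_[p] (domain b h01 h02 h12) = Module.finrank ℤ_[p] L := by
  have := Module.Finite.of_basis b
  have := Module.Free.of_basis b
  have : IsNoetherian ℤ_[p] L := isNoetherian_of_isNoetherianRing_of_finite _ _
  apply le_antisymm
  · exact Submodule.finrank_le (domain b h01 h02 h12).toSubmodule
  · refine LinearMap.finrank_le_finrank_of_injective
      (M' := (domain b h01 h02 h12).toSubmodule)
      (f := (LinearMap.lsmul ℤ_[p] L (p : ℤ_[p])).codRestrict (domain b h01 h02 h12).toSubmodule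
        (smul_mem_domain b h01 h02 h12)) ?_
    intro v w h
    have h' : (p : ℤ_[p]) • v = (p : ℤ_[p]) • w := congrArg Subtype.val h
    exact smul_right_injective L (PadicInt.prime_p (p := p)).ne_zero h'

/-- The virtual endomorphism with the above morphism. -/
noncomputable def virtualEndomorphism : VirtualEndomorphism p L where
  domain := domain b h01 h02 h12
  finrank_domain := finrank_domain b h01 h02 h12
  hom := hom b h01 h02 h12

theorem index_virtualEndomorphism : (virtualEndomorphism b h01 h02 h12).index = p := by
  let f : L →+ ZMod p := (PadicInt.toZMod : ℤ_[p] →+* ZMod p).toAddMonoidHom.comp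
    (b.coord 1).toAddMonoidHom
  have hker : (virtualEndomorphism b h01 h02 h12).domain.toSubmodule.toAddSubgroup = f.ker := by
    ext v
    rw [AddMonoidHom.mem_ker]
    exact (PadicInt.toZMod_eq_zero_iff_dvd _).symm
  have hsurj : Function.Surjective f := by
    intro z
    obtain ⟨x, rfl⟩ := PadicInt.toZMod_surjective z
    refine ⟨x • b 1, ?_⟩
    change PadicInt.toZMod (b.coord 1 (x • b 1)) = _
    simp
  rw [VirtualEndomorphism.index, hker, AddSubgroup.index_ker,
    AddMonoidHom.range_eq_top.2 hsurj, AddSubgroup.card_top, Nat.card_zmod]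

/-- Each application of the morphism divides the coordinate along `b 1` by `p`, so on an invariant
ideal this coordinate is infinitely divisible, hence zero. Bracketing with `b 1` moves the
coordinate along `b 0` to `b 1`, and that along `b 2` to `b 0`, up to nonzero factors, so these
vanish too. -/
theorem isSimple_virtualEndomorphism (hα : α ≠ 0) (hγ : γ ≠ 0) :
    (virtualEndomorphism b h01 h02 h12).IsSimple := by
  rintro I ⟨hI, hinv⟩
  have hpow : ∀ n : ℕ, ∀ v ∈ I, (p : ℤ_[p]) ^ n ∣ b.coord 1 v := by
    intro n
    induction n with
    | zero => intro v _; simp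
    | succ n ih =>
      intro v hv
      have h1 := ih _ (hinv ⟨v, hI v hv⟩ hv)
      change _ ∣ b.coord 1 (_ • b 0 + _ • b 1 + _ • b 2) at h1
      rw [(coord_comb b _ _ _).2.1] at h1
      rw [← mul_quot b h01 h02 h12 ⟨v, hI v hv⟩, pow_succ']
      exact mul_dvd_mul_left _ h1
  have hzero : ∀ v ∈ I, b.coord 1 v = 0 := fun v hv =>
    PadicInt.eq_zero_of_forall_pow_dvd fun n => hpow n v hv
  have hlie : ∀ v ∈ I, b.coord 0 v = 0 := by
    intro v hv
    have h := hzero _ (lie_mem_right ℤ_[p] L I (b 1) v hv)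
    rw [(coord_lie b h01 h02 h12 _ _).2.1, hzero v hv] at h
    simpa [hα] using h
  rw [eq_bot_iff]
  intro v hv
  have h := hlie _ (lie_mem_right ℤ_[p] L I (b 1) v hv)
  rw [(coord_lie b h01 h02 h12 _ _).1, hzero v hv] at h
  have h2 : b.coord 2 v = 0 := by simpa [hγ] using h
  rw [LieSubmodule.mem_bot, eq_sum_coord b v, hlie v hv, hzero v hv, h2]
  simp

end

theorem isSelfSimilarOfIndex (h01 : ⁅b 0, b 1⁆ = -(α • b 1)) (h02 : ⁅b 0, b 2⁆ = α • b 2)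
    (h12 : ⁅b 1, b 2⁆ = γ • b 0) (hα : α ≠ 0) (hγ : γ ≠ 0) : IsSelfSimilarOfIndex p L p :=
  ⟨(Fact.out : p.Prime).one_le, virtualEndomorphism b h01 h02 h12,
    isSimple_virtualEndomorphism b h01 h02 h12 hα hγ, index_virtualEndomorphism b h01 h02 h12⟩

end SplitTriple

end SelfSimilar

/-! ### Diagonalization of symmetric matrices by congruence. -/

namespace Matrix

/-- Congruence of matrices up to a unit factor. -/
def UnitCongruent {n R : Type*} [Fintype n] [DecidableEq n] [CommRing R] (A B : Matrix n n R) :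
    Prop :=
  ∃ (Q : Matrix n n R) (u : R), IsUnit Q.det ∧ IsUnit u ∧ B = u • (Q * A * Qᵀ)

namespace UnitCongruent

section General

variable {n R : Type*} [Fintype n] [DecidableEq n] [CommRing R] {A B C : Matrix n n R}

theorem of_eq (Q : Matrix n n R) (hQ : IsUnit Q.det) (h : B = Q * A * Qᵀ) : UnitCongruent A B :=
  ⟨Q, 1, hQ, isUnit_one, by rw [one_smul, h]⟩

theorem trans (h : UnitCongruent A B) (h' : UnitCongruent B C) : UnitCongruent A C := by
  obtain ⟨Q, u, hQ, hu, rfl⟩ := h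
  obtain ⟨Q', u', hQ', hu', rfl⟩ := h'
  refine ⟨Q' * Q, u' * u, by rw [det_mul]; exact hQ'.mul hQ, hu'.mul hu, ?_⟩
  simp only [transpose_mul, Matrix.mul_smul, Matrix.smul_mul, smul_smul, Matrix.mul_assoc]

theorem isSymm (h : UnitCongruent A B) (hA : A.IsSymm) : B.IsSymm := by
  obtain ⟨Q, u, -, -, rfl⟩ := h
  rw [IsSymm, transpose_smul, transpose_mul, transpose_mul, transpose_transpose, hA.eq,
    Matrix.mul_assoc]

theorem det_ne_zero [IsDomain R] (h : UnitCongruent A B) (hA : A.det ≠ 0) : B.det ≠ 0 := by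
  obtain ⟨Q, u, hQ, hu, rfl⟩ := h
  rw [det_smul, det_mul, det_mul, det_transpose]
  exact mul_ne_zero (pow_ne_zero _ hu.ne_zero)
    (mul_ne_zero (mul_ne_zero hQ.ne_zero hA) hQ.ne_zero)

theorem diagonal_comp_perm (d : n → R) (σ : Equiv.Perm n) :
    UnitCongruent (diagonal d) (diagonal (d ∘ σ)) := by
  refine of_eq ((1 : Matrix n n R).submatrix σ id) ?_ ?_
  · rw [det_permute, det_one, mul_one]
    exact (Units.isUnit _).map (Int.castRingHom R)
  · ext i j
    simp [Matrix.mul_apply, diagonal_apply, Matrix.one_apply]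
    split_ifs with h
    · rw [h]
    · rfl

theorem diagonal_mul_sq (d c : n → R) (hc : ∀ i, IsUnit (c i)) {u : R} (hu : IsUnit u) :
    UnitCongruent (diagonal d) (diagonal fun i => u * c i ^ 2 * d i) := by
  refine ⟨diagonal c, u, ?_, hu, ?_⟩
  · rw [det_diagonal, IsUnit.prod_univ_iff]; exact hc
  · rw [diagonal_transpose, diagonal_mul_diagonal, diagonal_mul_diagonal, ← diagonal_smul]
    congr 1; ext i; simp; ring

end General

section Three

variable {R : Type*} [CommRing R]

theorem _root_.Matrix.mul_mul_transpose_apply_fin_three (Q A : Matrix (Fin 3) (Fin 3) R)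
    (i j : Fin 3) : (Q * A * Qᵀ) i j =
      Q i 0 * (A 0 0 * Q j 0 + A 0 1 * Q j 1 + A 0 2 * Q j 2) +
      Q i 1 * (A 1 0 * Q j 0 + A 1 1 * Q j 1 + A 1 2 * Q j 2) +
      Q i 2 * (A 2 0 * Q j 0 + A 2 1 * Q j 1 + A 2 2 * Q j 2) := by
  simp only [Matrix.mul_apply, Fin.sum_univ_three, transpose_apply]
  ring

theorem exists_first_row_eq (v : Fin 3 → R) (i : Fin 3) (hi : v i = 1) :
    ∃ Q : Matrix (Fin 3) (Fin 3) R, IsUnit Q.det ∧ ∀ k, Q 0 k = v k := by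
  fin_cases i
  · refine ⟨!![v 0, v 1, v 2; 0, 1, 0; 0, 0, 1], ?_, ?_⟩
    · simp at hi
      simp [det_fin_three, hi]
    · intro k; fin_cases k <;> rfl
  · refine ⟨!![v 0, v 1, v 2; 1, 0, 0; 0, 0, 1], ?_, ?_⟩
    · simp at hi
      simp [det_fin_three, hi]
    · intro k; fin_cases k <;> rfl
  · refine ⟨!![v 0, v 1, v 2; 0, 1, 0; 1, 0, 0], ?_, ?_⟩
    · simp at hi
      simp [det_fin_three, hi]
    · intro k; fin_cases k <;> rfl

/-- Pick an entry `A i j` dividing all others. If neither `A i i` nor `A j j` divides it, the form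
takes on `e i + e j` the value `A i j` times 2 plus a nonunit, which is a unit multiple of `A i j`.
The chosen vector has a coordinate 1, so it extends to an invertible matrix. -/
theorem exists_zero_zero_dvd [IsDomain R] [ValuationRing R] (h2 : IsUnit (2 : R))
    {A : Matrix (Fin 3) (Fin 3) R} (hA : A.IsSymm) :
    ∃ B, UnitCongruent A B ∧ ∀ i j, B 0 0 ∣ B i j := by
  obtain ⟨⟨i, j⟩, hij⟩ : ∃ z : Fin 3 × Fin 3, ∀ w : Fin 3 × Fin 3, A z.1 z.2 ∣ A w.1 w.2 := by
    have hD : Directed (fun x y : R => y ∣ x) (fun w : Fin 3 × Fin 3 => A w.1 w.2) := by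
      intro x y
      rcases ValuationRing.dvd_total (A x.1 x.2) (A y.1 y.2) with h | h
      · exact ⟨x, dvd_rfl, h⟩
      · exact ⟨y, h, dvd_rfl⟩
    have : IsTrans R (fun x y : R => y ∣ x) := ⟨fun _ _ _ h h' => h'.trans h⟩
    obtain ⟨z, hz⟩ := hD.finset_le Finset.univ
    exact ⟨z, fun w => hz w (Finset.mem_univ w)⟩
  have hdvd : ∀ k l, A i j ∣ A k l := fun k l => hij (k, l)
  suffices h : ∃ (v : Fin 3 → R) (k : Fin 3), v k = 1 ∧ (∑ k, ∑ l, v k * v l * A k l) ∣ A i j by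
    obtain ⟨v, k, hk, hv⟩ := h
    obtain ⟨Q, hQ, hQv⟩ := exists_first_row_eq v k hk
    refine ⟨_, of_eq Q hQ rfl, fun k l => ?_⟩
    have h0 : (Q * A * Qᵀ) 0 0 = ∑ k, ∑ l, v k * v l * A k l := by
      simp only [Matrix.mul_apply, Fin.sum_univ_three, transpose_apply, hQv]; ring
    rw [h0]
    refine hv.trans ?_
    rw [Matrix.mul_apply]
    refine Finset.dvd_sum fun m _ => Dvd.dvd.mul_right ?_ _
    rw [Matrix.mul_apply]
    exact Finset.dvd_sum fun m' _ => Dvd.dvd.mul_left (hdvd _ _) _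
  have hsingle : ∀ k, (∑ m, ∑ l, (Pi.single k 1 : Fin 3 → R) m * (Pi.single k 1 : Fin 3 → R) l
      * A m l) = A k k := by
    intro k
    simp [Pi.single_apply]
  by_cases hi : A i i ∣ A i j
  · exact ⟨Pi.single i 1, i, by simp, by rw [hsingle]; exact hi⟩
  by_cases hj : A j j ∣ A i j
  · exact ⟨Pi.single j 1, j, by simp, by rw [hsingle]; exact hj⟩
  have hne : i ≠ j := by rintro rfl; exact hi dvd_rfl
  obtain ⟨s, hs⟩ := hdvd i i
  obtain ⟨t, ht⟩ := hdvd j j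
  have hsu : ¬ IsUnit s := fun h => hi (by rw [hs]; exact (h.mul_right_dvd).2 dvd_rfl)
  have htu : ¬ IsUnit t := fun h => hj (by rw [ht]; exact (h.mul_right_dvd).2 dvd_rfl)
  have hu : IsUnit (2 + (s + t)) := by
    by_contra hn
    have h3 : ¬ IsUnit (s + t) := IsLocalRing.nonunits_add hsu htu
    have h4 : ¬ IsUnit ((2 + (s + t)) + -(s + t)) :=
      IsLocalRing.nonunits_add hn (by rwa [mem_nonunits_iff, IsUnit.neg_iff])
    exact h4 (by rwa [add_neg_cancel_right])
  refine ⟨Pi.single i 1 + Pi.single j 1, i, by simp [hne], ?_⟩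
  have : (∑ k, ∑ l, (Pi.single i 1 + Pi.single j 1 : Fin 3 → R) k *
      (Pi.single i 1 + Pi.single j 1 : Fin 3 → R) l * A k l) = A i j * (2 + (s + t)) := by
    have hsym : A j i = A i j := hA.apply i j
    have : (∑ k, ∑ l, (Pi.single i 1 + Pi.single j 1 : Fin 3 → R) k *
      (Pi.single i 1 + Pi.single j 1 : Fin 3 → R) l * A k l) = A i i + A i j + (A j i + A j j) := by
      simp [Pi.single_apply, add_mul, mul_add, Finset.sum_add_distrib]
      ring
    rw [this, hsym]
    linear_combination hs + ht
  rw [this]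
  exact hu.mul_right_dvd.2 dvd_rfl

theorem exists_block_diagonal {A : Matrix (Fin 3) (Fin 3) R} (hA : A.IsSymm)
    (h : ∀ i j, A 0 0 ∣ A i j) :
    ∃ a b c d, UnitCongruent A !![a, 0, 0; 0, b, c; 0, c, d] := by
  obtain ⟨s, hs⟩ := h 0 1
  obtain ⟨t, ht⟩ := h 0 2
  have hs' : A 1 0 = A 0 0 * s := (hA.apply 0 1).trans hs
  have ht' : A 2 0 = A 0 0 * t := (hA.apply 0 2).trans ht
  have h12 : A 2 1 = A 1 2 := hA.apply 1 2
  refine ⟨A 0 0, A 1 1 - A 0 0 * s ^ 2, A 1 2 - A 0 0 * s * t, A 2 2 - A 0 0 * t ^ 2,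
    of_eq !![1, 0, 0; -s, 1, 0; -t, 0, 1] (by simp [det_fin_three]) ?_⟩
  ext i j
  rw [mul_mul_transpose_apply_fin_three]
  fin_cases i <;> fin_cases j <;>
    simp [hs, ht, hs', ht', h12] <;> ring

theorem block_diagonal_of_dvd {a b c d : R} (h : b ∣ c) :
    ∃ e, UnitCongruent !![a, 0, 0; 0, b, c; 0, c, d] (diagonal e) := by
  obtain ⟨t, rfl⟩ := h
  refine ⟨![a, b, d - b * t ^ 2], of_eq !![1, 0, 0; 0, 1, 0; 0, -t, 1] (by simp [det_fin_three]) ?_⟩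
  ext i j
  rw [mul_mul_transpose_apply_fin_three]
  fin_cases i <;> fin_cases j <;>
    simp <;> ring

theorem block_diagonal [IsDomain R] [ValuationRing R] (h2 : IsUnit (2 : R)) (a b c d : R) :
    ∃ e, UnitCongruent !![a, 0, 0; 0, b, c; 0, c, d] (diagonal e) := by
  by_cases hb : b ∣ c
  · exact block_diagonal_of_dvd hb
  by_cases hd : d ∣ c
  · obtain ⟨e, he⟩ := block_diagonal_of_dvd (a := a) (d := b) hd
    refine ⟨e, UnitCongruent.trans (of_eq !![1, 0, 0; 0, 0, 1; 0, 1, 0] ?_ ?_) he⟩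
    · simp [det_fin_three]
    · ext i j
      rw [mul_mul_transpose_apply_fin_three]
      fin_cases i <;> fin_cases j <;> simp
  obtain ⟨s, rfl⟩ := (ValuationRing.dvd_total b c).resolve_left hb
  obtain ⟨t, rfl⟩ := (ValuationRing.dvd_total d c).resolve_left hd
  have hsu : ¬ IsUnit s := fun h => hb (h.mul_right_dvd.2 dvd_rfl)
  have htu : ¬ IsUnit t := fun h => hd (h.mul_right_dvd.2 dvd_rfl)
  have hu : IsUnit (2 + (s + t)) := by
    by_contra hn
    have h3 : ¬ IsUnit (s + t) := IsLocalRing.nonunits_add hsu htu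
    have h4 : ¬ IsUnit ((2 + (s + t)) + -(s + t)) :=
      IsLocalRing.nonunits_add hn (by rwa [mem_nonunits_iff, IsUnit.neg_iff])
    exact h4 (by rwa [add_neg_cancel_right])
  -- Adding the last basis vector to the middle one replaces `b` by `c * (2 + (s + t))`, a unit
  -- multiple of `c`, so the divisible case applies.
  have hdvd : c * (2 + (s + t)) ∣ c + c * t := by
    rw [hu.mul_right_dvd]; exact Dvd.intro (1 + t) (by ring)
  obtain ⟨e, he⟩ := block_diagonal_of_dvd (a := a) (d := c * t) hdvd
  refine ⟨e, UnitCongruent.trans (of_eq !![1, 0, 0; 0, 1, 1; 0, 0, 1] ?_ ?_) he⟩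
  · simp [det_fin_three]
  · ext i j
    rw [mul_mul_transpose_apply_fin_three]
    fin_cases i <;> fin_cases j <;> simp
    ring

theorem exists_diagonal [IsDomain R] [ValuationRing R] (h2 : IsUnit (2 : R))
    {A : Matrix (Fin 3) (Fin 3) R} (hA : A.IsSymm) : ∃ d, UnitCongruent A (diagonal d) := by
  obtain ⟨B, hAB, hB⟩ := exists_zero_zero_dvd h2 hA
  obtain ⟨a, b, c, d, hC⟩ := exists_block_diagonal (hAB.isSymm hA) hB
  obtain ⟨e, he⟩ := block_diagonal h2 a b c d
  exact ⟨e, (hAB.trans hC).trans he⟩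

/-- The vector `(x, y)` takes the value `t`, and `(-v y, u x)` is orthogonal to it with value `u * v
* t`; the change of basis has determinant 1. -/
theorem diagonal_pair_left {u v x y : R} (h : u * x ^ 2 + v * y ^ 2 = 1) (t w : R) :
    UnitCongruent (diagonal ![u * t, v * t, w]) (diagonal ![t, u * v * t, w]) := by
  refine of_eq !![x, y, 0; -(v * y), u * x, 0; 0, 0, 1] ?_ ?_
  · have : (!![x, y, 0; -(v * y), u * x, 0; 0, 0, 1] : Matrix (Fin 3) (Fin 3) R).det = 1 := by
      simp [det_fin_three]; linear_combination h
    rw [this]; exact isUnit_one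
  · ext i j
    rw [mul_mul_transpose_apply_fin_three]
    fin_cases i <;> fin_cases j <;>
      simp <;>
      first | ring1 | linear_combination (-t) * h | linear_combination (-(u * v * t)) * h

theorem diagonal_pair_right {u v x y : R} (h : u * x ^ 2 + v * y ^ 2 = 1) (t w : R) :
    UnitCongruent (diagonal ![w, u * t, v * t]) (diagonal ![w, t, u * v * t]) := by
  refine of_eq !![1, 0, 0; 0, x, y; 0, -(v * y), u * x] ?_ ?_
  · have : (!![1, 0, 0; 0, x, y; 0, -(v * y), u * x] : Matrix (Fin 3) (Fin 3) R).det = 1 := by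
      simp [det_fin_three]; linear_combination h
    rw [this]; exact isUnit_one
  · ext i j
    rw [mul_mul_transpose_apply_fin_three]
    fin_cases i <;> fin_cases j <;>
      simp <;>
      first | ring1 | linear_combination (-t) * h | linear_combination (-(u * v * t)) * h

end Three

end UnitCongruent

end Matrix

open Matrix

/-! ### Coefficient matrices of brackets. -/

section BracketMatrix

variable {R : Type*} [CommRing R] {L : Type*} [LieRing L] [LieAlgebra R L]

/-- The brackets of the vectors `y 0, y 1, y 2` are the combinations of these vectors with the
coefficients `A`. -/
def HasBrackets (y : Fin 3 → L) (A : Matrix (Fin 3) (Fin 3) R) : Prop :=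
  ⁅y 1, y 2⁆ = A 0 0 • y 0 + A 0 1 • y 1 + A 0 2 • y 2 ∧
  ⁅y 2, y 0⁆ = A 1 0 • y 0 + A 1 1 • y 1 + A 1 2 • y 2 ∧
  ⁅y 0, y 1⁆ = A 2 0 • y 0 + A 2 1 • y 1 + A 2 2 • y 2

theorem Module.Basis.exists_of_isUnit_det (y : Module.Basis (Fin 3) R L)
    (P : Matrix (Fin 3) (Fin 3) R) (hP : IsUnit P.det) :
    ∃ y' : Module.Basis (Fin 3) R L, ∀ i, y' i = P i 0 • y 0 + P i 1 • y 1 + P i 2 • y 2 := by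
  let v : Fin 3 → L := fun i => P i 0 • y 0 + P i 1 • y 1 + P i 2 • y 2
  have hv : y.toMatrix v = Pᵀ := by
    ext i j
    rw [Module.Basis.toMatrix_apply, transpose_apply]
    fin_cases i <;> simp [v]
  have hdet : IsUnit (y.det v) := by
    rw [Module.Basis.det_apply, hv, det_transpose]; exact hP
  obtain ⟨h1, h2⟩ := y.is_basis_iff_det.2 hdet
  exact ⟨Module.Basis.mk h1 h2.ge, fun i => by simp [v]⟩

theorem lie_comb_comb {y w : Fin 3 → L} (h0 : ⁅y 1, y 2⁆ = w 0) (h1 : ⁅y 2, y 0⁆ = w 1)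
    (h2 : ⁅y 0, y 1⁆ = w 2) (a b c a' b' c' : R) :
    ⁅a • y 0 + b • y 1 + c • y 2, a' • y 0 + b' • y 1 + c' • y 2⁆ =
      (b * c' - c * b') • w 0 + (c * a' - a * c') • w 1 + (a * b' - b * a') • w 2 := by
  have h0' : ⁅y 2, y 1⁆ = -w 0 := by rw [← h0, lie_skew]
  have h1' : ⁅y 0, y 2⁆ = -w 1 := by rw [← h1, lie_skew]
  have h2' : ⁅y 1, y 0⁆ = -w 2 := by rw [← h2, lie_skew]
  simp only [lie_add, add_lie, lie_smul, smul_lie, lie_self, h0, h1, h2, h0', h1', h2']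
  module

/-- A change of basis `P` turns `A` into `cof P * A * P⁻¹`. For `P = u • cof Q` one has `cof P = u ^
2 * det Q • Q` and `P⁻¹ = (u * det Q)⁻¹ • Qᵀ`, and the scalars combine to `u`. -/
theorem HasBrackets.exists_of_unitCongruent {y : Module.Basis (Fin 3) R L}
    {A B : Matrix (Fin 3) (Fin 3) R} (hy : HasBrackets y A) (h : UnitCongruent A B) :
    ∃ y' : Module.Basis (Fin 3) R L, HasBrackets y' B := by
  obtain ⟨Q, u, hQ, hu, rfl⟩ := h
  obtain ⟨y', hy'⟩ := y.exists_of_isUnit_det (u • Q.minorMatrix) (by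
    have : (u • Q.minorMatrix).det = u ^ 3 * Q.det ^ 2 := by
      rw [det_smul, Fintype.card_fin]
      simp [det_fin_three, minorMatrix]
      ring
    rw [this]
    exact (hu.pow 3).mul (hQ.pow 2))
  obtain ⟨h0, h1, h2⟩ := hy
  let w : Fin 3 → L := fun i => A i 0 • y 0 + A i 1 • y 1 + A i 2 • y 2
  have hw : ∀ i, w i = A i 0 • y 0 + A i 1 • y 1 + A i 2 • y 2 := fun i => rfl
  have key : ∀ i, (u ^ 2 * Q.det) • (Q i 0 • w 0 + Q i 1 • w 1 + Q i 2 • w 2) =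
      (u • (Q * A * Qᵀ)) i 0 • y' 0 + (u • (Q * A * Qᵀ)) i 1 • y' 1
        + (u • (Q * A * Qᵀ)) i 2 • y' 2 := by
    intro i
    have hrow : ∀ j, (Q * A * Qᵀ) i j =
        (Q * A) i 0 * Q j 0 + (Q * A) i 1 * Q j 1 + (Q * A) i 2 * Q j 2 := by
      intro j
      rw [Matrix.mul_apply, Fin.sum_univ_three]; rfl
    have hl : Q i 0 • w 0 + Q i 1 • w 1 + Q i 2 • w 2 =
        (Q * A) i 0 • y 0 + (Q * A) i 1 • y 1 + (Q * A) i 2 • y 2 := by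
      simp only [hw, Matrix.mul_apply, Fin.sum_univ_three]
      module
    rw [hl]
    simp only [Matrix.smul_apply, hrow, hy', det_fin_three, smul_eq_mul]
    generalize (Q * A) i 0 = r0
    generalize (Q * A) i 1 = r1
    generalize (Q * A) i 2 = r2
    simp only [minorMatrix, of_apply, cons_val', cons_val_zero, cons_val_one, cons_val,
      cons_val_fin_one]
    match_scalars <;> ring
  refine ⟨y', ?_, ?_, ?_⟩
  · rw [← key 0, hy' 1, hy' 2, lie_comb_comb (w := w) h0 h1 h2]
    simp only [Matrix.smul_apply, det_fin_three, smul_eq_mul]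
    simp only [minorMatrix, of_apply, cons_val', cons_val_zero, cons_val_one, cons_val,
      cons_val_fin_one]
    generalize w 0 = w0
    generalize w 1 = w1
    generalize w 2 = w2
    match_scalars <;> ring
  · rw [← key 1, hy' 2, hy' 0, lie_comb_comb (w := w) h0 h1 h2]
    simp only [Matrix.smul_apply, det_fin_three, smul_eq_mul]
    simp only [minorMatrix, of_apply, cons_val', cons_val_zero, cons_val_one, cons_val,
      cons_val_fin_one]
    generalize w 0 = w0
    generalize w 1 = w1
    generalize w 2 = w2
    match_scalars <;> ring
  · rw [← key 2, hy' 0, hy' 1, lie_comb_comb (w := w) h0 h1 h2]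
    simp only [Matrix.smul_apply, det_fin_three, smul_eq_mul]
    simp only [minorMatrix, of_apply, cons_val', cons_val_zero, cons_val_one, cons_val,
      cons_val_fin_one]
    generalize w 0 = w0
    generalize w 1 = w1
    generalize w 2 = w2
    match_scalars <;> ring

theorem HasBrackets.exists_matrix (y : Module.Basis (Fin 3) R L) :
    ∃ A : Matrix (Fin 3) (Fin 3) R, HasBrackets y A := by
  have h : ∀ v : L, v = y.repr v 0 • y 0 + y.repr v 1 • y 1 + y.repr v 2 • y 2 := by
    intro v
    conv_lhs => rw [← y.sum_repr v, Fin.sum_univ_three]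
  exact ⟨of ![y.repr ⁅y 1, y 2⁆, y.repr ⁅y 2, y 0⁆, y.repr ⁅y 0, y 1⁆], h _, h _, h _⟩

/-- The Jacobi identity on the basis says that the vector of the antisymmetric part of `A` lies in
the left kernel of `A`. -/
theorem HasBrackets.isSymm [IsDomain R] {y : Module.Basis (Fin 3) R L}
    {A : Matrix (Fin 3) (Fin 3) R} (hy : HasBrackets y A) (hA : A.det ≠ 0) : A.IsSymm := by
  obtain ⟨h0, h1, h2⟩ := hy
  have hj := lie_jacobi (y 0) (y 1) (y 2)
  have h0' : ⁅y 2, y 1⁆ = -⁅y 1, y 2⁆ := (lie_skew _ _).symm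
  have h1' : ⁅y 0, y 2⁆ = -⁅y 2, y 0⁆ := (lie_skew _ _).symm
  have h2' : ⁅y 1, y 0⁆ = -⁅y 0, y 1⁆ := (lie_skew _ _).symm
  have hlin : (A 1 2 - A 2 1) • ⁅y 1, y 2⁆ + (A 2 0 - A 0 2) • ⁅y 2, y 0⁆
      + (A 0 1 - A 1 0) • ⁅y 0, y 1⁆ = 0 := by
    rw [← hj]
    conv_rhs =>
      rw [h0, h1, h2]
    simp only [lie_add, lie_smul, lie_self, h0', h1', h2']
    module
  rw [h0, h1, h2] at hlin
  have hvec : ![A 1 2 - A 2 1, A 2 0 - A 0 2, A 0 1 - A 1 0] ᵥ* A = 0 := by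
    have hli := Fintype.linearIndependent_iff.1 y.linearIndependent
      (![A 1 2 - A 2 1, A 2 0 - A 0 2, A 0 1 - A 1 0] ᵥ* A) (by
        rw [← hlin, Fin.sum_univ_three]
        simp only [vecMul, dotProduct, Fin.sum_univ_three, cons_val_zero, cons_val_one, cons_val]
        module)
    exact funext hli
  have hz := eq_zero_of_vecMul_eq_zero hA hvec
  have e0 : A 1 2 - A 2 1 = 0 := congrFun hz 0
  have e1 : A 2 0 - A 0 2 = 0 := congrFun hz 1
  have e2 : A 0 1 - A 1 0 = 0 := congrFun hz 2
  ext i j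
  fin_cases i <;> fin_cases j <;> simp [transpose_apply] <;>
    first
      | linear_combination e0
      | linear_combination -e0
      | linear_combination e1
      | linear_combination -e1
      | linear_combination e2
      | linear_combination -e2

/-- Up to the factor `c`, the derived algebra lies in a span of two vectors, the second derived
algebra in the span of their bracket, and the third is zero because there is no torsion. -/
theorem isSolvable_of_smul_lie_mem_span [IsDomain R] [Module.IsTorsionFree R L] {c : R} (hc : c ≠ 0)
    (e f : L) (h : ∀ x y : L, ∃ r s : R, c • ⁅x, y⁆ = r • e + s • f) :
    LieAlgebra.IsSolvable L := by
  have h1 : ∀ x ∈ LieAlgebra.derivedSeries R L 1, ∃ r s : R, c • x = r • e + s • f := by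
    intro x hx
    rw [LieAlgebra.derivedSeries_def, LieAlgebra.derivedSeriesOfIdeal_succ, ← LieSubmodule.mem_toSubmodule,
      LieSubmodule.lieIdeal_oper_eq_linear_span'] at hx
    induction hx using Submodule.span_induction with
    | mem x hx =>
      obtain ⟨m, -, n, -, rfl⟩ := hx
      exact h m n
    | zero => exact ⟨0, 0, by simp⟩
    | add x y _ _ hx hy =>
      obtain ⟨r, s, hx⟩ := hx
      obtain ⟨r', s', hy⟩ := hy
      exact ⟨r + r', s + s', by rw [smul_add, hx, hy]; module⟩
    | smul t x _ hx =>
      obtain ⟨r, s, hx⟩ := hx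
      exact ⟨t * r, t * s, by rw [smul_comm, hx]; module⟩
  have h2 : ∀ x ∈ LieAlgebra.derivedSeries R L 2, ∃ r : R, (c * c) • x = r • ⁅e, f⁆ := by
    intro x hx
    rw [LieAlgebra.derivedSeries_def, LieAlgebra.derivedSeriesOfIdeal_succ, ← LieSubmodule.mem_toSubmodule,
      LieSubmodule.lieIdeal_oper_eq_linear_span'] at hx
    induction hx using Submodule.span_induction with
    | mem x hx =>
      obtain ⟨m, hm, n, hn, rfl⟩ := hx
      obtain ⟨r, s, hm⟩ := h1 m hm
      obtain ⟨r', s', hn⟩ := h1 n hn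
      refine ⟨r * s' - s * r', ?_⟩
      have : (c * c) • ⁅m, n⁆ = ⁅c • m, c • n⁆ := by rw [smul_lie, lie_smul, smul_smul]
      rw [this, hm, hn]
      have hfe : ⁅f, e⁆ = -⁅e, f⁆ := (lie_skew _ _).symm
      simp only [lie_add, add_lie, lie_smul, smul_lie, lie_self, hfe]
      module
    | zero => exact ⟨0, by simp⟩
    | add x y _ _ hx hy =>
      obtain ⟨r, hx⟩ := hx
      obtain ⟨r', hy⟩ := hy
      exact ⟨r + r', by rw [smul_add, hx, hy]; module⟩
    | smul t x _ hx =>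
      obtain ⟨r, hx⟩ := hx
      exact ⟨t * r, by rw [smul_comm, hx]; module⟩
  refine LieAlgebra.IsSolvable.mk (R := R) (k := 3) ?_
  rw [LieAlgebra.derivedSeries_def, LieAlgebra.derivedSeriesOfIdeal_succ,
    LieSubmodule.lie_eq_bot_iff]
  intro x hx y hy
  obtain ⟨r, hx⟩ := h2 x hx
  obtain ⟨s, hy⟩ := h2 y hy
  have : ((c * c) * (c * c)) • ⁅x, y⁆ = 0 := by
    have : ((c * c) * (c * c)) • ⁅x, y⁆ = ⁅(c * c) • x, (c * c) • y⁆ := by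
      rw [smul_lie, lie_smul, smul_smul]
    rw [this, hx, hy, smul_lie, lie_smul, lie_self, smul_zero, smul_zero]
  exact (smul_eq_zero.1 this).resolve_left
    (mul_ne_zero (mul_ne_zero hc hc) (mul_ne_zero hc hc))

theorem HasBrackets.isSolvable [IsDomain R] {y : Module.Basis (Fin 3) R L}
    {A : Matrix (Fin 3) (Fin 3) R} (hy : HasBrackets y A) (hA : A.det = 0) :
    LieAlgebra.IsSolvable L := by
  have := Module.Free.of_basis y
  -- A dependence between the rows of `A` is a linear relation between the three brackets. A nonzero
  -- coefficient of it eliminates one of them, up to that scalar.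
  obtain ⟨c, hc, hcA⟩ := exists_vecMul_eq_zero_iff.2 hA
  have hlin : c 0 • ⁅y 1, y 2⁆ + c 1 • ⁅y 2, y 0⁆ + c 2 • ⁅y 0, y 1⁆ = 0 := by
    have e : ∀ j, c 0 * A 0 j + c 1 * A 1 j + c 2 * A 2 j = 0 := by
      intro j
      have := congrFun hcA j
      simpa [vecMul, dotProduct, Fin.sum_univ_three] using this
    obtain ⟨h0, h1, h2⟩ := hy
    rw [h0, h1, h2]
    have : (c 0 * A 0 0 + c 1 * A 1 0 + c 2 * A 2 0) • y 0 +
        (c 0 * A 0 1 + c 1 * A 1 1 + c 2 * A 2 1) • y 1 +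
        (c 0 * A 0 2 + c 1 * A 1 2 + c 2 * A 2 2) • y 2 = 0 := by
      rw [e, e, e]; simp
    rw [← this]
    module
  have hgen : ∀ x x' : L, ∃ α β γ : R,
      ⁅x, x'⁆ = α • ⁅y 1, y 2⁆ + β • ⁅y 2, y 0⁆ + γ • ⁅y 0, y 1⁆ := by
    intro x x'
    have h : ∀ v : L, v = y.repr v 0 • y 0 + y.repr v 1 • y 1 + y.repr v 2 • y 2 := by
      intro v
      conv_lhs => rw [← y.sum_repr v, Fin.sum_univ_three]
    rw [h x, h x']
    exact ⟨_, _, _, lie_comb_comb (w := ![⁅y 1, y 2⁆, ⁅y 2, y 0⁆, ⁅y 0, y 1⁆]) rfl rfl rfl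
      _ _ _ _ _ _⟩
  obtain ⟨i, hi⟩ := Function.ne_iff.1 hc
  fin_cases i
  · refine isSolvable_of_smul_lie_mem_span (R := R) hi ⁅y 2, y 0⁆ ⁅y 0, y 1⁆ fun x x' => ?_
    obtain ⟨α, β, γ, h⟩ := hgen x x'
    refine ⟨c 0 * β - α * c 1, c 0 * γ - α * c 2, ?_⟩
    rw [h]
    simp only [Fin.zero_eta]
    linear_combination (norm := module) α • hlin
  · refine isSolvable_of_smul_lie_mem_span (R := R) hi ⁅y 1, y 2⁆ ⁅y 0, y 1⁆ fun x x' => ?_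
    obtain ⟨α, β, γ, h⟩ := hgen x x'
    refine ⟨c 1 * α - β * c 0, c 1 * γ - β * c 2, ?_⟩
    rw [h]
    simp only [Fin.mk_one]
    linear_combination (norm := module) β • hlin
  · refine isSolvable_of_smul_lie_mem_span (R := R) hi ⁅y 1, y 2⁆ ⁅y 2, y 0⁆ fun x x' => ?_
    obtain ⟨α, β, γ, h⟩ := hgen x x'
    refine ⟨c 2 * α - γ * c 0, c 2 * β - γ * c 1, ?_⟩
    rw [h]
    simp only [Fin.reduceFinMk]
    linear_combination (norm := module) γ • hlin

theorem HasBrackets.nonempty_lieEquiv {y : Module.Basis (Fin 3) R L} {a : Fin 3 → R}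
    (hy : HasBrackets y (diagonal a)) : Nonempty (L ≃ₗ⁅R⁆ DiagLieLattice a) := by
  obtain ⟨h0, h1, h2⟩ := hy
  simp at h0 h1 h2
  obtain ⟨f, hf, -⟩ := DiagLieLattice.existsUnique_lift a y h0 h1 h2
  have hbij : Function.Bijective f := by
    have : (f : DiagLieLattice a →ₗ[R] L) =
        ((DiagLieLattice.stdBasis a).equiv y (Equiv.refl _) : DiagLieLattice a →ₗ[R] L) :=
      (DiagLieLattice.stdBasis a).ext fun i => by
        rw [LinearEquiv.coe_coe, Module.Basis.equiv_apply]; exact hf i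
    have h := ((DiagLieLattice.stdBasis a).equiv y (Equiv.refl _)).bijective
    have e : ⇑f = ⇑((DiagLieLattice.stdBasis a).equiv y (Equiv.refl _)) :=
      funext fun v => LinearMap.congr_fun this v
    rw [e]; exact h
  exact ⟨(LieEquiv.ofBijective f hbij).symm⟩

theorem HasBrackets.exists_of_lieEquiv {a : Fin 3 → R} (e : L ≃ₗ⁅R⁆ DiagLieLattice a) :
    ∃ y : Module.Basis (Fin 3) R L, HasBrackets y (diagonal a) := by
  refine ⟨(DiagLieLattice.stdBasis a).map e.symm.toLinearEquiv, ?_⟩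
  obtain ⟨h0, h1, h2⟩ := DiagLieLattice.stdBasis_relations a
  have hy : ∀ i, (DiagLieLattice.stdBasis a).map e.symm.toLinearEquiv i =
    e.symm (DiagLieLattice.stdBasis a i) := fun i => rfl
  refine ⟨?_, ?_, ?_⟩ <;> simp only [hy, ← LieEquiv.map_lie, h0, h1, h2] <;> simp

end BracketMatrix

/-! ### Reduction to the canonical parameters, and their uniqueness. -/

section Canonical

variable {p : ℕ} [Fact p.Prime]

namespace CanonicalParam

theorem exists_sorted {d : Fin 3 → ℤ_[p]} (hd : ∀ i, d i ≠ 0) :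
    ∃ (s₀ s₁ s₂ : ℕ) (u₀ u₁ u₂ : ℤ_[p]ˣ), s₀ ≤ s₁ ∧ s₁ ≤ s₂ ∧
      UnitCongruent (diagonal d) (diagonal ![(u₀ : ℤ_[p]) * (p : ℤ_[p]) ^ s₀,
        (u₁ : ℤ_[p]) * (p : ℤ_[p]) ^ s₁, (u₂ : ℤ_[p]) * (p : ℤ_[p]) ^ s₂]) := by
  let f : Fin 3 → ℕ := fun i => (d i).valuation
  let σ := Tuple.sort f
  have hmono : Monotone (f ∘ σ) := Tuple.monotone_sort f
  refine ⟨f (σ 0), f (σ 1), f (σ 2), PadicInt.unitCoeff (hd (σ 0)), PadicInt.unitCoeff (hd (σ 1)),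
    PadicInt.unitCoeff (hd (σ 2)), hmono (by decide : (0 : Fin 3) ≤ 1),
    hmono (by decide : (1 : Fin 3) ≤ 2), ?_⟩
  convert UnitCongruent.diagonal_comp_perm d σ using 2
  funext i
  fin_cases i
  · exact (PadicInt.unitCoeff_spec (hd (σ 0))).symm
  · exact (PadicInt.unitCoeff_spec (hd (σ 1))).symm
  · exact (PadicInt.unitCoeff_spec (hd (σ 2))).symm

theorem unitCongruent_rescale {d d' : Fin 3 → ℤ_[p]} (u c₀ c₁ c₂ : ℤ_[p]ˣ)
    (h₀ : d' 0 = u * (c₀ : ℤ_[p]) ^ 2 * d 0) (h₁ : d' 1 = u * (c₁ : ℤ_[p]) ^ 2 * d 1)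
    (h₂ : d' 2 = u * (c₂ : ℤ_[p]) ^ 2 * d 2) : UnitCongruent (diagonal d) (diagonal d') := by
  convert UnitCongruent.diagonal_mul_sq d ![(c₀ : ℤ_[p]), (c₁ : ℤ_[p]), (c₂ : ℤ_[p])] (by
    intro i; fin_cases i <;> simp) u.isUnit using 2
  funext i
  fin_cases i
  · exact h₀
  · exact h₁
  · exact h₂

theorem exists_unitCongruent (hp : 3 ≤ p) (ρ : ℤ_[p]ˣ)
    (hρ : ¬ IsSquare (PadicInt.toZMod (ρ : ℤ_[p]))) {d : Fin 3 → ℤ_[p]} (hd : ∀ i, d i ≠ 0) :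
    ∃ c : CanonicalParam, UnitCongruent (diagonal d) (diagonal (c.coeff ρ)) := by
  obtain ⟨s₀, s₁, s₂, u₀, u₁, u₂, h₀₁, h₁₂, h⟩ := exists_sorted hd
  have hinv : ∀ u : ℤ_[p]ˣ, ((u⁻¹ : ℤ_[p]ˣ) : ℤ_[p]) * u = 1 := fun u => u.inv_mul
  rcases h₀₁.lt_or_eq with h₀₁ | rfl
  · rcases h₁₂.lt_or_eq with h₁₂ | rfl
    · obtain ⟨ε₁, c₁, e₁⟩ := PadicInt.exists_eq_pow_mul_sq hp ρ hρ (u₀⁻¹ * u₁)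
      obtain ⟨ε₂, c₂, e₂⟩ := PadicInt.exists_eq_pow_mul_sq hp ρ hρ (u₀⁻¹ * u₂)
      rw [Units.val_mul] at e₁ e₂
      refine ⟨L₁ s₀ s₁ s₂ h₀₁ h₁₂ ε₁ ε₂, h.trans (unitCongruent_rescale u₀⁻¹ 1 c₁ c₂ ?_ ?_ ?_)⟩
      · simp [coeff]
      · simp [coeff, e₁]; ring
      · simp [coeff, e₂]; ring
    · obtain ⟨x, y, hxy⟩ := PadicInt.exists_mul_sq_add_mul_sq_eq_one hp (u₀⁻¹ * u₁).isUnit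
        (u₀⁻¹ * u₂).isUnit
      obtain ⟨ε, c, e⟩ := PadicInt.exists_eq_pow_mul_sq hp ρ hρ (-((u₀⁻¹ * u₁) * (u₀⁻¹ * u₂)))
      simp only [Units.val_mul, Units.val_neg] at hxy e
      refine ⟨L₃ s₀ s₁ h₀₁ ε, (h.trans (unitCongruent_rescale u₀⁻¹ 1 1 1 ?_ ?_ ?_)).trans
        ((UnitCongruent.diagonal_pair_right hxy ((p : ℤ_[p]) ^ s₁) ((p : ℤ_[p]) ^ s₀)).trans
          (unitCongruent_rescale 1 1 1 c ?_ ?_ ?_))⟩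
      · simp
      · simp; ring
      · simp; ring
      · simp [coeff]
      · simp [coeff]
      · simp [coeff, e]; ring
  · rcases h₁₂.lt_or_eq with h₁₂ | rfl
    · obtain ⟨x, y, hxy⟩ := PadicInt.exists_mul_sq_add_mul_sq_eq_one hp (u₂⁻¹ * u₀).isUnit
        (u₂⁻¹ * u₁).isUnit
      obtain ⟨ε, c, e⟩ := PadicInt.exists_eq_pow_mul_sq hp ρ hρ (-((u₂⁻¹ * u₀) * (u₂⁻¹ * u₁)))
      simp only [Units.val_mul, Units.val_neg] at hxy e
      refine ⟨L₂ s₀ s₂ h₁₂ ε, (h.trans (unitCongruent_rescale u₂⁻¹ 1 1 1 ?_ ?_ ?_)).trans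
        ((UnitCongruent.diagonal_pair_left hxy ((p : ℤ_[p]) ^ s₀) ((p : ℤ_[p]) ^ s₂)).trans
          (unitCongruent_rescale 1 1 c 1 ?_ ?_ ?_))⟩
      · simp; ring
      · simp; ring
      · simp
      · simp [coeff]
      · simp [coeff, e]; ring
      · simp [coeff]
    -- Up to the factor `p ^ s₀`, the diagonal passes through `(1, u₀ u₁, u₂)`, `(1, 1, δ)`, `(δ, δ,
    -- 1)` by scaling with `δ`, and `(1, δ ^ 2, 1)`, whose square is removed last.
    · let δ := u₀ * u₁ * u₂
      obtain ⟨x, y, hxy⟩ := PadicInt.exists_mul_sq_add_mul_sq_eq_one hp u₀.isUnit u₁.isUnit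
      obtain ⟨x', y', hxy'⟩ := PadicInt.exists_mul_sq_add_mul_sq_eq_one hp (u₀ * u₁).isUnit
        u₂.isUnit
      obtain ⟨x'', y'', hxy''⟩ := PadicInt.exists_mul_sq_add_mul_sq_eq_one hp δ.isUnit δ.isUnit
      rw [Units.val_mul] at hxy'
      have e := hinv δ
      refine ⟨L₄ s₀, h.trans ((UnitCongruent.diagonal_pair_left hxy _ _).trans
        ((UnitCongruent.diagonal_pair_right hxy' _ _).trans
        ((unitCongruent_rescale δ 1 1 δ⁻¹ (d' := ![(δ : ℤ_[p]) * (p : ℤ_[p]) ^ s₀,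
          (δ : ℤ_[p]) * (p : ℤ_[p]) ^ s₀, (p : ℤ_[p]) ^ s₀]) ?_ ?_ ?_).trans
        ((UnitCongruent.diagonal_pair_left hxy'' _ _).trans
          (unitCongruent_rescale 1 1 δ⁻¹ 1 ?_ ?_ ?_)))))⟩
      · simp
      · simp
      · have hδ : (u₀ : ℤ_[p]) * u₁ * u₂ = δ := by simp [δ]
        simp only [cons_val, hδ]
        linear_combination (-(p : ℤ_[p]) ^ s₀ * (1 + ((δ⁻¹ : ℤ_[p]ˣ) : ℤ_[p]) * δ)) * e
      · simp [coeff]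
      · simp only [coeff, cons_val_one, cons_val_zero, Units.val_one]
        linear_combination (-(p : ℤ_[p]) ^ s₀ * (1 + ((δ⁻¹ : ℤ_[p]ˣ) : ℤ_[p]) * δ)) * e
      · simp [coeff]

/-- The valuations of the coefficients. -/
def exponent : CanonicalParam → Fin 3 → ℕ
  | L₁ s₀ s₁ s₂ _ _ _ _ => ![s₀, s₁, s₂]
  | L₂ s₀ s₂ _ _ => ![s₀, s₀, s₂]
  | L₃ s₀ s₁ _ _ => ![s₀, s₁, s₁]
  | L₄ s₀ => ![s₀, s₀, s₀]

theorem exponent_le (c : CanonicalParam) :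
    c.exponent 0 ≤ c.exponent 1 ∧ c.exponent 1 ≤ c.exponent 2 := by
  cases c <;> simp [exponent] <;> omega

theorem exists_coeff_eq (ρ : ℤ_[p]ˣ) (c : CanonicalParam) :
    ∃ v : Fin 3 → ℤ_[p], (∀ i, IsUnit (v i)) ∧
      ∀ i, c.coeff ρ i = v i * (p : ℤ_[p]) ^ c.exponent i := by
  cases c with
  | L₁ s₀ s₁ s₂ _ _ ε₁ ε₂ =>
    refine ⟨![1, (ρ : ℤ_[p]) ^ (ε₁ : ℕ), (ρ : ℤ_[p]) ^ (ε₂ : ℕ)], ?_, ?_⟩ <;> intro i <;>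
      fin_cases i <;> simp [coeff, exponent, ρ.isUnit.pow]
  | L₂ s₀ s₂ _ ε₁ =>
    refine ⟨![1, -(ρ : ℤ_[p]) ^ (ε₁ : ℕ), 1], ?_, ?_⟩ <;> intro i <;>
      fin_cases i <;> simp [coeff, exponent, ρ.isUnit.pow]
  | L₃ s₀ s₁ _ ε₂ =>
    refine ⟨![1, 1, -(ρ : ℤ_[p]) ^ (ε₂ : ℕ)], ?_, ?_⟩ <;> intro i <;>
      fin_cases i <;> simp [coeff, exponent, ρ.isUnit.pow]
  | L₄ s₀ =>
    refine ⟨![1, 1, 1], ?_, ?_⟩ <;> intro i <;>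
      fin_cases i <;> simp [coeff, exponent]

end CanonicalParam

namespace DiagLieLattice

theorem exists_isScaledHom_of_lieEquiv {a a' : Fin 3 → ℤ_[p]} (ha : ∀ i, a i ≠ 0)
    (f : DiagLieLattice a ≃ₗ⁅ℤ_[p]⁆ DiagLieLattice a') :
    ∃ (G : Matrix (Fin 3) (Fin 3) ℤ_[p]) (e : ℤ_[p]), IsUnit e ∧
      (∀ i, a' i * e = a 0 * G i 0 ^ 2 + a 1 * G i 1 ^ 2 + a 2 * G i 2 ^ 2) ∧
      (∀ j, formCoeff a' 0 * G 0 j ^ 2 + formCoeff a' 1 * G 1 j ^ 2 + formCoeff a' 2 * G 2 j ^ 2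
        = formCoeff a j) ∧
      a' 0 * a' 1 * a' 2 * e = a 0 * a 1 * a 2 := by
  have hG := isScaledHom_of_map_lie (c := 1) (f : DiagLieLattice a →ₗ[ℤ_[p]] DiagLieLattice a')
    (fun x y => by rw [one_smul]; exact (LieEquiv.map_lie f x y).symm)
  have hu := LinearEquiv.isUnit_det f.toLinearEquiv (stdBasis a) (stdBasis a')
  have he : LinearMap.toMatrix (stdBasis a) (stdBasis a')
      (f.toLinearEquiv : DiagLieLattice a →ₗ[ℤ_[p]] DiagLieLattice a') =
      of fun i j => (f : DiagLieLattice a →ₗ[ℤ_[p]] DiagLieLattice a') (stdBasis a j) i := by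
    ext i j
    rw [LinearMap.toMatrix_apply]
    rfl
  rw [he] at hu
  generalize of (fun i j => (f : DiagLieLattice a →ₗ[ℤ_[p]] DiagLieLattice a') (stdBasis a j) i)
    = G at hG hu
  have hΔ : a' 0 * a' 1 * a' 2 * G.det = a 0 * a 1 * a 2 := by
    apply mul_right_cancel₀ hu.ne_zero
    linear_combination hG.det_sq
  refine ⟨G, G.det, hu, fun i => ?_, fun j => ?_, hΔ⟩
  · rw [hG.mul_det, one_mul]
  · apply mul_left_cancel₀ (ha j)
    have h := hG.mul_form j
    rw [one_mul, hΔ] at h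
    rw [h]
    fin_cases j <;> simp [formCoeff] <;> ring

end DiagLieLattice

namespace CanonicalParam

open DiagLieLattice

theorem pow_dvd_unit_mul_pow {v : ℤ_[p]} (hv : IsUnit v) {k s : ℕ}
    (h : (p : ℤ_[p]) ^ k ∣ v * (p : ℤ_[p]) ^ s) : k ≤ s :=
  (pow_dvd_pow_iff PadicInt.prime_p.ne_zero PadicInt.prime_p.not_isUnit).1 (hv.dvd_mul_left.1 h)

theorem coeff_ne_zero (ρ : ℤ_[p]ˣ) (c : CanonicalParam) (i : Fin 3) : c.coeff ρ i ≠ 0 := by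
  obtain ⟨v, hv, h⟩ := c.exists_coeff_eq ρ
  rw [h]
  exact mul_ne_zero (hv i).ne_zero (pow_ne_zero _ PadicInt.prime_p.ne_zero)

/-- The bounds come from the smallest valuation of a coefficient, the smallest valuation of a
coefficient of the invariant form, and the product of all coefficients. With the same bounds for the
inverse map they become equalities. -/
theorem exponent_le_of_lieEquiv {ρ : ℤ_[p]ˣ} {c c' : CanonicalParam}
    (f : c.lattice ρ ≃ₗ⁅ℤ_[p]⁆ c'.lattice ρ) :
    c.exponent 0 ≤ c'.exponent 0 ∧
    c'.exponent 0 + c'.exponent 1 ≤ c.exponent 0 + c.exponent 1 ∧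
    c'.exponent 0 + c'.exponent 1 + c'.exponent 2
      ≤ c.exponent 0 + c.exponent 1 + c.exponent 2 := by
  obtain ⟨G, e, he, hdet, hform, hΔ⟩ := exists_isScaledHom_of_lieEquiv (c.coeff_ne_zero ρ) f
  obtain ⟨v, hv, hc⟩ := c.exists_coeff_eq ρ
  obtain ⟨v', hv', hc'⟩ := c'.exists_coeff_eq ρ
  obtain ⟨l01, l12⟩ := c.exponent_le
  obtain ⟨l01', l12'⟩ := c'.exponent_le
  refine ⟨?_, ?_, ?_⟩
  · refine pow_dvd_unit_mul_pow ((hv' 0).mul he) ?_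
    have h := hdet 0
    rw [hc', hc, hc, hc] at h
    have : v' 0 * e * (p : ℤ_[p]) ^ c'.exponent 0 = v' 0 * (p : ℤ_[p]) ^ c'.exponent 0 * e := by
      ring
    rw [this, h]
    refine dvd_add (dvd_add ?_ ?_) ?_ <;> refine Dvd.dvd.mul_right (Dvd.dvd.mul_left ?_ _) _ <;>
      exact pow_dvd_pow _ (by omega)
  · refine pow_dvd_unit_mul_pow ((hv 0).mul (hv 1)) ?_
    have h := hform 2
    simp only [formCoeff, cons_val_zero, cons_val_one, cons_val, hc, hc'] at h
    have : v 0 * v 1 * (p : ℤ_[p]) ^ (c.exponent 0 + c.exponent 1) =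
      v 0 * (p : ℤ_[p]) ^ c.exponent 0 * (v 1 * (p : ℤ_[p]) ^ c.exponent 1) := by ring
    rw [this, ← h]
    have hd : ∀ (x y : ℤ_[p]) (i j : ℕ), c'.exponent 0 + c'.exponent 1 ≤ i + j →
        (p : ℤ_[p]) ^ (c'.exponent 0 + c'.exponent 1) ∣
          x * (p : ℤ_[p]) ^ i * (y * (p : ℤ_[p]) ^ j) := by
      intro x y i j hij
      rw [mul_mul_mul_comm, ← pow_add]
      exact (pow_dvd_pow _ hij).mul_left _
    refine dvd_add (dvd_add ?_ ?_) ?_ <;> refine Dvd.dvd.mul_right (hd _ _ _ _ ?_) _ <;> omega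
  · refine pow_dvd_unit_mul_pow (((hv 0).mul (hv 1)).mul (hv 2)) ?_
    rw [hc, hc, hc, hc', hc', hc'] at hΔ
    refine ⟨v' 0 * v' 1 * v' 2 * e, ?_⟩
    linear_combination -hΔ

theorem exponent_eq_of_lieEquiv {ρ : ℤ_[p]ˣ} {c c' : CanonicalParam}
    (f : c.lattice ρ ≃ₗ⁅ℤ_[p]⁆ c'.lattice ρ) :
    c.exponent 0 = c'.exponent 0 ∧ c.exponent 1 = c'.exponent 1 ∧
      c.exponent 2 = c'.exponent 2 := by
  have h := exponent_le_of_lieEquiv f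
  have h' := exponent_le_of_lieEquiv f.symm
  omega

theorem eq_of_lieEquiv {ρ : ℤ_[p]ˣ} (hρ : ¬ IsSquare (PadicInt.toZMod (ρ : ℤ_[p])))
    {c c' : CanonicalParam} (f : c.lattice ρ ≃ₗ⁅ℤ_[p]⁆ c'.lattice ρ) : c = c' := by
  have hexp := exponent_eq_of_lieEquiv f
  obtain ⟨G, e, he, hdet, hform, hΔ⟩ := exists_isScaledHom_of_lieEquiv (c.coeff_ne_zero ρ) f
  have hdet0 := hdet 0
  have hform2 := hform 2
  have hpow : ∀ k, (p : ℤ_[p]) ^ k ≠ 0 := fun k => pow_ne_zero _ PadicInt.prime_p.ne_zero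
  -- The pattern of equalities among the exponents determines the family, so only the pairs from the
  -- same family survive.
  cases c <;> cases c' <;>
    simp only [exponent, cons_val_zero, cons_val_one, cons_val] at hexp <;>
    try omega
  · rename_i s₀ s₁ s₂ h₀₁ h₁₂ ε₁ ε₂ s₀' s₁' s₂' h₀₁' h₁₂' ε₁' ε₂'
    obtain ⟨rfl, rfl, rfl⟩ := hexp
    obtain ⟨m, rfl⟩ := Nat.exists_eq_add_of_lt h₀₁
    obtain ⟨n, rfl⟩ := Nat.exists_eq_add_of_lt h₁₂
    simp only [coeff, formCoeff, cons_val_zero, cons_val_one, cons_val] at hdet0 hform2 hΔ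
    -- After division by `p ^ (s₀ + s₁)`, the form on column 2 reads `ρ ^ ε₁' * G 2 2 ^ 2 ≡ ρ ^ ε₁`
    -- modulo `p`.
    have hε₁ : ε₁' = ε₁ := by
      refine PadicInt.exponent_eq_of_dvd hρ (x := G 2 2)
        ⟨-((p : ℤ_[p]) ^ m * (p : ℤ_[p]) ^ (n + 1) * ((ρ : ℤ_[p]) ^ (ε₁' : ℕ) *
          (ρ : ℤ_[p]) ^ (ε₂' : ℕ)) * G 0 2 ^ 2 + (p : ℤ_[p]) ^ n * (ρ : ℤ_[p]) ^ (ε₂' : ℕ)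
            * G 1 2 ^ 2),
          mul_left_cancel₀ (hpow (s₀ + (s₀ + m + 1))) ?_⟩
      linear_combination hform2
    subst hε₁
    -- Comparing the products of the coefficients gives `ρ ^ ε₂' * e = ρ ^ ε₂`, while row 0 gives `e
    -- ≡ G 0 0 ^ 2` modulo `p`.
    have hε₂ : ε₂' = ε₂ := by
      refine PadicInt.exponent_eq_of_dvd hρ (x := G 0 0)
        ⟨-((p : ℤ_[p]) ^ m * (ρ : ℤ_[p]) ^ (ε₁' : ℕ) * (ρ : ℤ_[p]) ^ (ε₂' : ℕ) * G 0 1 ^ 2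
          + (p : ℤ_[p]) ^ (m + n + 1) * (ρ : ℤ_[p]) ^ (ε₂ : ℕ) * (ρ : ℤ_[p]) ^ (ε₂' : ℕ) *
            G 0 2 ^ 2), ?_⟩
      have e1 : (ρ : ℤ_[p]) ^ (ε₂' : ℕ) * e = (ρ : ℤ_[p]) ^ (ε₂ : ℕ) := by
        apply mul_left_cancel₀ (mul_ne_zero (ρ.isUnit.pow (ε₁' : ℕ)).ne_zero
          (hpow (s₀ + (s₀ + m + 1) + (s₀ + m + 1 + n + 1))))
        linear_combination hΔ
      have e2 : e = G 0 0 ^ 2 + (ρ : ℤ_[p]) ^ (ε₁' : ℕ) * (p : ℤ_[p]) ^ (m + 1) * G 0 1 ^ 2 +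
          (ρ : ℤ_[p]) ^ (ε₂ : ℕ) * (p : ℤ_[p]) ^ (m + 1 + n + 1) * G 0 2 ^ 2 := by
        apply mul_left_cancel₀ (hpow s₀)
        linear_combination hdet0
      linear_combination e1 - (ρ : ℤ_[p]) ^ (ε₂' : ℕ) * e2
    subst hε₂
    rfl
  · rename_i s₀ s₂ h₀₂ ε₁ s₀' s₂' h₀₂' ε₁'
    obtain ⟨rfl, -, rfl⟩ := hexp
    obtain ⟨n, rfl⟩ := Nat.exists_eq_add_of_lt h₀₂
    simp only [coeff, formCoeff, cons_val_zero, cons_val_one, cons_val] at hdet0 hform2 hΔ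
    have hε₁ : ε₁' = ε₁ := by
      refine PadicInt.exponent_eq_of_dvd hρ (x := G 2 2)
        ⟨(p : ℤ_[p]) ^ n * (G 1 2 ^ 2 - (ρ : ℤ_[p]) ^ (ε₁' : ℕ) * G 0 2 ^ 2),
          mul_left_cancel₀ (hpow (s₀ + s₀)) ?_⟩
      linear_combination -hform2
    subst hε₁
    rfl
  · rename_i s₀ s₁ h₀₁ ε₂ s₀' s₁' h₀₁' ε₂'
    obtain ⟨rfl, rfl, -⟩ := hexp
    obtain ⟨m, rfl⟩ := Nat.exists_eq_add_of_lt h₀₁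
    simp only [coeff, formCoeff, cons_val_zero, cons_val_one, cons_val] at hdet0 hform2 hΔ
    have hε₂ : ε₂' = ε₂ := by
      refine PadicInt.exponent_eq_of_dvd hρ (x := G 0 0)
        ⟨-((p : ℤ_[p]) ^ m * (ρ : ℤ_[p]) ^ (ε₂' : ℕ) * (G 0 1 ^ 2 -
          (ρ : ℤ_[p]) ^ (ε₂ : ℕ) * G 0 2 ^ 2)), ?_⟩
      have e1 : (ρ : ℤ_[p]) ^ (ε₂' : ℕ) * e = (ρ : ℤ_[p]) ^ (ε₂ : ℕ) := by
        apply mul_left_cancel₀ (hpow (s₀ + (s₀ + m + 1) + (s₀ + m + 1)))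
        linear_combination -hΔ
      have e2 : e = G 0 0 ^ 2 + (p : ℤ_[p]) ^ (m + 1) * G 0 1 ^ 2 -
          (ρ : ℤ_[p]) ^ (ε₂ : ℕ) * (p : ℤ_[p]) ^ (m + 1) * G 0 2 ^ 2 := by
        apply mul_left_cancel₀ (hpow s₀)
        linear_combination hdet0
      linear_combination e1 - (ρ : ℤ_[p]) ^ (ε₂' : ℕ) * e2
    subst hε₂
    rfl
  · rename_i s₀ s₀'
    obtain ⟨rfl, -, -⟩ := hexp
    rfl

theorem exists_lieEquiv (hp : 3 ≤ p) (ρ : ℤ_[p]ˣ)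
    (hρ : ¬ IsSquare (PadicInt.toZMod (ρ : ℤ_[p]))) {L : Type*} [LieRing L] [LieAlgebra ℤ_[p] L]
    [Module.Free ℤ_[p] L] [Module.Finite ℤ_[p] L] (hrank : Module.finrank ℤ_[p] L = 3)
    (hL : ¬ LieAlgebra.IsSolvable L) :
    ∃ c : CanonicalParam, Nonempty (L ≃ₗ⁅ℤ_[p]⁆ c.lattice ρ) := by
  let y : Module.Basis (Fin 3) ℤ_[p] L := Module.finBasisOfFinrankEq ℤ_[p] L hrank
  obtain ⟨A, hA⟩ := HasBrackets.exists_matrix y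
  have hdet : A.det ≠ 0 := fun h => hL (hA.isSolvable h)
  obtain ⟨d, hd⟩ := UnitCongruent.exists_diagonal (PadicInt.isUnit_two hp) (hA.isSymm hdet)
  have hd0 : ∀ i, d i ≠ 0 := by
    have := hd.det_ne_zero hdet
    rw [det_diagonal, Finset.prod_ne_zero_iff] at this
    exact fun i => this i (Finset.mem_univ i)
  obtain ⟨c, hc⟩ := exists_unitCongruent hp ρ hρ hd0
  obtain ⟨y', hy'⟩ := hA.exists_of_unitCongruent (hd.trans hc)
  exact ⟨c, hy'.nonempty_lieEquiv⟩

end CanonicalParam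

/-! ### The self-similar lattices. -/

theorem HasBrackets.isSelfSimilar (hp : 3 ≤ p) {L : Type*} [LieRing L] [LieAlgebra ℤ_[p] L]
    {y : Module.Basis (Fin 3) ℤ_[p] L} {a b : ℤ_[p]} (ha : a ≠ 0) (hb : b ≠ 0)
    (hy : HasBrackets y (diagonal ![a, -a, b])) : IsSelfSimilarOfIndex p L p := by
  obtain ⟨h0, h1, h2⟩ := hy
  simp at h0 h1 h2
  -- `y 0 + y 1` and `y 0 - y 1` are eigenvectors of `ad (y 2)` for `-a` and `a`, and their bracket
  -- is `-2 * b` times `y 2`.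
  obtain ⟨y', hy'⟩ := y.exists_of_isUnit_det !![0, 0, 1; 1, 1, 0; 1, -1, 0] (by
    have : (!![0, 0, 1; 1, 1, 0; 1, -1, 0] : Matrix (Fin 3) (Fin 3) ℤ_[p]).det = -2 := by
      simp [det_fin_three]; norm_num
    rw [this]; exact (PadicInt.isUnit_two hp).neg)
  have e0 : y' 0 = y 2 := by simp [hy']
  have e1 : y' 1 = y 0 + y 1 := by simp [hy']
  have e2 : y' 2 = y 0 - y 1 := by simp [hy', sub_eq_add_neg]
  have h0' : ⁅y 2, y 1⁆ = -(a • y 0) := by rw [← h0, lie_skew]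
  have h2' : ⁅y 1, y 0⁆ = -(b • y 2) := by rw [← h2, lie_skew]
  refine SplitTriple.isSelfSimilarOfIndex y' (α := a) (γ := -2 * b) ?_ ?_ ?_ ha
    (mul_ne_zero (PadicInt.isUnit_two hp).neg.ne_zero hb)
  · rw [e0, e1, lie_add, h1, h0']; module
  · rw [e0, e2, lie_sub, h1, h0']; module
  · rw [e1, e2, e0]
    simp only [lie_sub, add_lie, lie_self, h2, h2']; module

theorem HasBrackets.exists_rotate {R : Type*} [CommRing R] {L : Type*} [LieRing L] [LieAlgebra R L]
    {y : Module.Basis (Fin 3) R L} {a b c : R} (hy : HasBrackets y (diagonal ![a, b, c])) :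
    ∃ y' : Module.Basis (Fin 3) R L, HasBrackets y' (diagonal ![b, c, a]) := by
  refine hy.exists_of_unitCongruent (UnitCongruent.of_eq !![0, 1, 0; 0, 0, 1; 1, 0, 0] ?_ ?_)
  · simp [det_fin_three]
  · ext i j
    rw [mul_mul_transpose_apply_fin_three]
    fin_cases i <;> fin_cases j <;> simp

theorem isSelfSimilar_diag (hp : 3 ≤ p) {a b : ℤ_[p]} (ha : a ≠ 0) (hb : b ≠ 0) :
    IsSelfSimilarOfIndex p (DiagLieLattice ![a, -a, b]) p := by
  obtain ⟨y, hy⟩ := HasBrackets.exists_of_lieEquiv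
    (LieEquiv.refl : DiagLieLattice ![a, -a, b] ≃ₗ⁅ℤ_[p]⁆ DiagLieLattice ![a, -a, b])
  exact hy.isSelfSimilar hp ha hb

end Canonical

theorem mainTheorem5 {p : ℕ} [Fact p.Prime] (hp : 3 ≤ p) (ρ : ℤ_[p]ˣ)
    (hρ : ¬ IsSquare (PadicInt.toZMod (ρ : ℤ_[p]))) :
    (∀ (L : Type*) [LieRing L] [LieAlgebra ℤ_[p] L] [Module.Free ℤ_[p] L] [Module.Finite ℤ_[p] L],
      Module.finrank ℤ_[p] L = 3 → ¬ LieAlgebra.IsSolvable L →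
        ∃! c : CanonicalParam, Nonempty (L ≃ₗ⁅ℤ_[p]⁆ c.lattice ρ)) ∧
    (∀ (s₀ s₁ s₂ : ℕ) (h₀₁ : s₀ < s₁) (h₁₂ : s₁ < s₂) (ε₁ ε₂ : Fin 2),
      ¬ IsSelfSimilarOfIndex p ((CanonicalParam.L₁ s₀ s₁ s₂ h₀₁ h₁₂ ε₁ ε₂).lattice ρ) p) ∧
    (∀ (s₀ s₂ : ℕ) (h₀₂ : s₀ < s₂) (ε₁ : Fin 2),
      IsSelfSimilarOfIndex p ((CanonicalParam.L₂ s₀ s₂ h₀₂ ε₁).lattice ρ) p ↔ ε₁ = 0) ∧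
    (∀ (s₀ s₁ : ℕ) (h₀₁ : s₀ < s₁) (ε₂ : Fin 2),
      IsSelfSimilarOfIndex p ((CanonicalParam.L₃ s₀ s₁ h₀₁ ε₂).lattice ρ) p ↔ ε₂ = 0) ∧
    (∀ s₀ : ℕ, IsSelfSimilarOfIndex p ((CanonicalParam.L₄ s₀).lattice ρ) p) := by
  have hpow : ∀ k, (p : ℤ_[p]) ^ k ≠ 0 := fun k => pow_ne_zero _ PadicInt.prime_p.ne_zero
  refine ⟨?_, ?_, ?_, ?_, ?_⟩
  · intro L _ _ _ _ hrank hL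
    obtain ⟨c, ⟨f⟩⟩ := CanonicalParam.exists_lieEquiv hp ρ hρ hrank hL
    refine ⟨c, ⟨f⟩, ?_⟩
    rintro c' ⟨f'⟩
    exact CanonicalParam.eq_of_lieEquiv hρ (f'.symm.trans f)
  · intro s₀ s₁ s₂ h₀₁ h₁₂ ε₁ ε₂
    have h := DiagLieLattice.not_isSelfSimilar_of_lt_of_lt (p := p) h₀₁ h₁₂ isUnit_one
      (ρ.isUnit.pow (ε₁ : ℕ)) (ρ.isUnit.pow (ε₂ : ℕ))
    rw [one_mul] at h
    exact h
  · intro s₀ s₂ h₀₂ ε₁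
    fin_cases ε₁
    · simp only [Fin.zero_eta, iff_true]
      have h := isSelfSimilar_diag hp (hpow s₀) (hpow s₂)
      have hc : (CanonicalParam.L₂ s₀ s₂ h₀₂ 0).coeff ρ =
          ![(p : ℤ_[p]) ^ s₀, -(p : ℤ_[p]) ^ s₀, (p : ℤ_[p]) ^ s₂] := by
        simp [CanonicalParam.coeff]
      rw [← hc] at h
      exact h
    · have h := DiagLieLattice.not_isSelfSimilar_of_eq_of_lt hρ ρ.isUnit h₀₂
      have hc : (CanonicalParam.L₂ s₀ s₂ h₀₂ 1).coeff ρ =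
          ![(p : ℤ_[p]) ^ s₀, -((ρ : ℤ_[p]) * (p : ℤ_[p]) ^ s₀), (p : ℤ_[p]) ^ s₂] := by
        simp [CanonicalParam.coeff]
      rw [← hc] at h
      exact ⟨fun h' => absurd h' h, fun h' => absurd h' (by decide)⟩
  · intro s₀ s₁ h₀₁ ε₂
    fin_cases ε₂
    · simp only [Fin.zero_eta, iff_true]
      obtain ⟨y, hy⟩ := HasBrackets.exists_of_lieEquiv
        (LieEquiv.refl : DiagLieLattice ![(p : ℤ_[p]) ^ s₀, (p : ℤ_[p]) ^ s₁, -(p : ℤ_[p]) ^ s₁]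
          ≃ₗ⁅ℤ_[p]⁆ _)
      obtain ⟨y', hy'⟩ := hy.exists_rotate
      have h := hy'.isSelfSimilar hp (hpow s₁) (hpow s₀)
      have hc : (CanonicalParam.L₃ s₀ s₁ h₀₁ 0).coeff ρ =
          ![(p : ℤ_[p]) ^ s₀, (p : ℤ_[p]) ^ s₁, -(p : ℤ_[p]) ^ s₁] := by
        simp [CanonicalParam.coeff]
      rw [← hc] at h
      exact h
    · have h := DiagLieLattice.not_isSelfSimilar_of_lt_of_eq hρ ρ.isUnit h₀₁
      have hc : (CanonicalParam.L₃ s₀ s₁ h₀₁ 1).coeff ρ =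
          ![(p : ℤ_[p]) ^ s₀, (p : ℤ_[p]) ^ s₁, -((ρ : ℤ_[p]) * (p : ℤ_[p]) ^ s₁)] := by
        simp [CanonicalParam.coeff]
      rw [← hc] at h
      exact ⟨fun h' => absurd h' h, fun h' => absurd h' (by decide)⟩
  · intro s₀
    obtain ⟨y, hy⟩ := HasBrackets.exists_of_lieEquiv
      (LieEquiv.refl : (CanonicalParam.L₄ s₀).lattice ρ ≃ₗ⁅ℤ_[p]⁆ _)
    -- Negating all coefficients and using that `-X ^ 2 - Y ^ 2` represents 1 turns `(1, 1, 1)` into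
    -- `(1, 1, -1)`, up to the factor `p ^ s₀`; a rotation gives the split shape `(1, -1, 1)`.
    obtain ⟨x, z, hxz⟩ := PadicInt.exists_mul_sq_add_mul_sq_eq_one hp
      (isUnit_one : IsUnit (1 : ℤ_[p])).neg (isUnit_one : IsUnit (1 : ℤ_[p])).neg
    have hcong : UnitCongruent (diagonal ((CanonicalParam.L₄ s₀).coeff ρ))
        (diagonal ![(p : ℤ_[p]) ^ s₀, -1 * -1 * (p : ℤ_[p]) ^ s₀, -(p : ℤ_[p]) ^ s₀]) := by
      refine (CanonicalParam.unitCongruent_rescale (-1) 1 1 1 ?_ ?_ ?_).trans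
        (UnitCongruent.diagonal_pair_left hxz _ _) <;> simp [CanonicalParam.coeff]
    obtain ⟨y', hy'⟩ := hy.exists_of_unitCongruent hcong
    rw [neg_mul_neg, one_mul, one_mul] at hy'
    obtain ⟨y'', hy''⟩ := hy'.exists_rotate
    exact hy''.isSelfSimilar hp (hpow s₀) (hpow s₀)
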